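/- Fix integers $r,h_0\ge 1$ and constants $\gamma>2$, $\delta\in[0,1]$, $K$, $\sigma_f,\sigma_\varepsilon,C_1,c>0$. Let $p=p_k\to\infty$ and $n=n_k\to\infty$. For each $k$ let $$x_t=A f_t+\varepsilon_t=A^s f_t^s+\varepsilon_t\in\mathbb R^p ,\qquad t\in\mathbb Z,$$ where $A^s\in\mathbb R^{p\times r}$ has the largest possible number of zero entries among all $p\times r$ matrices with the same column space as $A$, its columns have the same Euclidean norms as those of $A$, and they are ordered by increasing number of nonzero entries. Let $m$ be the number of nonzero entries of $A^s$. All objects may depend on $k$ (so $A^s$, the processes and the probability space form a triangular array), while $r,h_0$ and the constants above do not. For a process $y_t$ put $\Sigma_y(h)=\frac1{n-h}\sum_{t=1}^{n-h}\mathrm E(y_ty_{t+h}^\top)$, $\hat\Sigma_y(h)=\frac1{n-h}\sum_{t=1}^{n-h}y_ty_{t+h}^\top$, $M=\sum_{h=1}^{h_0}\Sigma_x(h)\Sigma_x(h)^\top$ and $\hat M=\sum_{h=1}^{h_0}\hat\Sigma_x(h)\hat\Sigma_x(h)^\top$. Write $a_k\asymp b_k$ if $a_k/b_k$ converges to a positive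 constant. Assume: (C1) the $\alpha$-mixing coefficients $\alpha(t)=\sup_i\sup\{|P(E\cap F)-P(E)P(F)|: E\in\sigma(f^s_u,u\le i),\ F\in\sigma(f^s_u,u\ge i+t)\}$ satisfy $\sum_{t\ge1}\alpha(t)^{1-2/\gamma}\le K$; (C2) $\mathrm E f^s_{t,i}=0$ and $\mathrm E|f^s_{t,i}|^{2\gamma}<\sigma_f^{2\gamma}$ for $1\le t\le n$, $1\le i\le r$; (C3) the vectors $\varepsilon_t$ are square integrable for $1\le t\le n$, independent over $t$, and, conditionally on the factor process $\mathcal F=\sigma(f^s_u,u\in\mathbb Z)$, for $1\le s\neq t\le n$: $\mathrm E(\varepsilon_t\mid\mathcal F)=0$, $\mathrm E(\varepsilon_s\varepsilon_t^\top\mid\mathcal F)=0$, and each entry of $\mathrm E(\varepsilon_t\varepsilon_t^\top\mid\mathcal F)$ is at most $\sigma_\varepsilon^2$ in absolute value, almost surely (for instance, the noise is independent of the factors, centred and serially independent, with covariances bounded by $\sigma_\varepsilon^2$); (C4) $\|A^s\|_2^2\asymp\|A^s\|_{\min}^2\asymp m^{1-\delta}$, where $\|\cdot\|_2$ is the largest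 and $\|\cdot\|_{\min}$ the smallest nonzero singular value, and all entries of $A^s$ are at most $C_1$ in absolute value; (C5) for all large $k$, $M$ has exactly $r$ distinct nonzero eigenvalues, and the smallest eigenvalue of $\sum_{h=1}^{h_0}\Sigma_{f^s}(h)\Sigma_{f^s}(h)^\top$ is at least $c$. Assume further that $m^{\delta-1}pn^{-1/2}=o(1)$. Let $Q$ be $A^s$ with each column divided by the norm of its component orthogonal to the preceding columns, let $S$ be obtained from $Q$ by the Gram–Schmidt process, and let $\hat S$ be any maximizer of $\operatorname{tr}(T^\top\hat MT)$ over $p\times r$ matrices $T$ with $T^\top T=I_r$ (for example, the matrix of orthonormal eigenvectors of $\hat M$ for its $r$ largest eigenvalues). Write $\mathcal M(Z)$ for the column space of $Z$ and $\Pi_{\mathcal M(Z)}$ for the orthogonal projection onto it. Then $$\bigl\|\Pi_{\mathcal M(\hat S)}-\Pi_{\mathcal M(S)}\bigr\|_2=O_p\bigl(m^{\delta-1}pn^{-1/2}\bigr),$$ and likewise $\mathcal D(\mathcal M(\hat S),\mathcal M(S))=\bigl(1-\tfrac1r\operatorname{tr}(\Pi_{\mathcal M(\hat S)}\Pi_{\mathcal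 M(S)})\bigr)^{1/2}=O_p\bigl(m^{\delta-1}pn^{-1/2}\bigr)$. -/

import Mathlib

open MeasureTheory ProbabilityTheory Filter Topology

noncomputable section

namespace FactorModel

/-! ### Matrices and subspaces -/

/-- The `j`-th column of `Z`, as a vector of Euclidean space. -/
def col {p r : ℕ} (Z : Matrix (Fin p) (Fin r) ℝ) (j : Fin r) : EuclideanSpace ℝ (Fin p) :=
  WithLp.toLp 2 (fun i => Z i j)

/-- `ℳ(Z)`, the space spanned by the columns of `Z`. -/
def colSpace {p r : ℕ} (Z : Matrix (Fin p) (Fin r) ℝ) :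
    Submodule ℝ (EuclideanSpace ℝ (Fin p)) :=
  Submodule.span ℝ (Set.range (col Z))

/-- The number of nonzero entries of `Z`. -/
def nnz {p r : ℕ} (Z : Matrix (Fin p) (Fin r) ℝ) : ℕ :=
  {ij : Fin p × Fin r | Z ij.1 ij.2 ≠ 0}.ncard

/-- The number of nonzero entries of the `j`-th column of `Z`. -/
def nnzCol {p r : ℕ} (Z : Matrix (Fin p) (Fin r) ℝ) (j : Fin r) : ℕ :=
  {i : Fin p | Z i j ≠ 0}.ncard

open scoped Matrix.Norms.L2Operator in
/-- The spectral norm `‖Z‖₂`. -/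
def specNorm {p r : ℕ} (Z : Matrix (Fin p) (Fin r) ℝ) : ℝ := ‖Z‖

/-- `‖Z‖_min`, the smallest nonzero singular value of `Z`. -/
def minSing {p r : ℕ} (Z : Matrix (Fin p) (Fin r) ℝ) : ℝ :=
  sInf {s : ℝ | 0 < s ∧
    Module.End.HasEigenvalue (Matrix.toLin' (Matrix.transpose Z * Z)) (s ^ 2)}

/-- The spectral norm of the difference of the orthogonal projections onto two subspaces. -/
def projDist {p : ℕ} (U V : Submodule ℝ (EuclideanSpace ℝ (Fin p))) : ℝ :=
  ‖U.starProjection - V.starProjection‖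

/-- The distance `(1 - tr(H₁H₁ᵀH₂H₂ᵀ)/r)^{1/2}` of two `r`-dimensional subspaces; `HᵢHᵢᵀ` is the
orthogonal projection when the columns of `Hᵢ` form an orthonormal basis. -/
def traceDist {p : ℕ} (r : ℕ) (U V : Submodule ℝ (EuclideanSpace ℝ (Fin p))) : ℝ :=
  Real.sqrt (1 - LinearMap.trace ℝ (EuclideanSpace ℝ (Fin p))
    ((U.starProjection ∘L V.starProjection).toLinearMap) / r)

/-! ### The loading matrices `Aˢ`, `Q`, `S` -/

/-- `As` is a sparsest loading matrix in the loading space of `A`, with the same column norms as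
`A` and with columns ordered by their number of nonzero entries. -/
structure IsSparseLoading {p r : ℕ} (A As : Matrix (Fin p) (Fin r) ℝ) : Prop where
  colSpace_eq : colSpace As = colSpace A
  sparsest : ∀ B : Matrix (Fin p) (Fin r) ℝ, colSpace B = colSpace A → nnz As ≤ nnz B
  norm_col : ∀ i, ‖col As i‖ = ‖col A i‖
  mono : Monotone (nnzCol As)

/-- The standardized loading matrix `Q`: each column of `As` is rescaled so that its component
orthogonal to the preceding columns has norm one. -/
def stdLoading {p r : ℕ} (As : Matrix (Fin p) (Fin r) ℝ) : Matrix (Fin p) (Fin r) ℝ :=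
  Matrix.of fun i j => ‖InnerProductSpace.gramSchmidt ℝ (col As) j‖⁻¹ * As i j

/-- The matrix `S` obtained from `Q` by the Gram–Schmidt process. -/
def orthLoading {p r : ℕ} (As : Matrix (Fin p) (Fin r) ℝ) : Matrix (Fin p) (Fin r) ℝ :=
  Matrix.of fun i j => InnerProductSpace.gramSchmidt ℝ (col (stdLoading As)) j i

/-! ### Population and sample autocovariances, and the estimator -/

section Cov

variable {Ω : Type*} [MeasurableSpace Ω]

/-- `(n-h)⁻¹ ∑_{t=1}^{n-h} E(y_t y_{t+h}ᵀ)`. -/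
def autocov (P : Measure Ω) {d : ℕ} (y : ℤ → Ω → Fin d → ℝ) (n h : ℕ) :
    Matrix (Fin d) (Fin d) ℝ :=
  Matrix.of fun i j =>
    ((n : ℝ) - (h : ℝ))⁻¹ * ∑ t ∈ Finset.Icc 1 (n - h), ∫ ω, y (t : ℤ) ω i * y ((t : ℤ) + h) ω j ∂P

/-- `(n-h)⁻¹ ∑_{t=1}^{n-h} y_t y_{t+h}ᵀ`. -/
def sampleAutocov {d : ℕ} (y : ℤ → Ω → Fin d → ℝ) (n h : ℕ) (ω : Ω) :
    Matrix (Fin d) (Fin d) ℝ :=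
  Matrix.of fun i j =>
    ((n : ℝ) - (h : ℝ))⁻¹ * ∑ t ∈ Finset.Icc 1 (n - h), y (t : ℤ) ω i * y ((t : ℤ) + h) ω j

/-- `∑_{h=1}^{h₀} Σ_y(h) Σ_y(h)ᵀ`. -/
def covM (P : Measure Ω) {d : ℕ} (y : ℤ → Ω → Fin d → ℝ) (n h₀ : ℕ) : Matrix (Fin d) (Fin d) ℝ :=
  ∑ h ∈ Finset.Icc 1 h₀, autocov P y n h * Matrix.transpose (autocov P y n h)

/-- The sample version of `covM`. -/
def sampleM {d : ℕ} (y : ℤ → Ω → Fin d → ℝ) (n h₀ : ℕ) (ω : Ω) : Matrix (Fin d) (Fin d) ℝ :=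
  ∑ h ∈ Finset.Icc 1 h₀, sampleAutocov y n h ω * Matrix.transpose (sampleAutocov y n h ω)

/-- `S` maximizes `tr(TᵀMT)` over all `p × r` matrices `T` with `TᵀT = I`; in particular this holds
if the columns of `S` are orthonormal eigenvectors for the `r` largest eigenvalues of `M`. -/
def IsEigenEstimator {p r : ℕ} (M : Matrix (Fin p) (Fin p) ℝ) (S : Matrix (Fin p) (Fin r) ℝ) :
    Prop :=
  Matrix.transpose S * S = 1 ∧
    ∀ T : Matrix (Fin p) (Fin r) ℝ, Matrix.transpose T * T = 1 →
      Matrix.trace (Matrix.transpose T * M * T) ≤ Matrix.trace (Matrix.transpose S * M * S)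

/-! ### The conditions -/

/-- The σ-field generated by `f_t`, `t ∈ I`. -/
abbrev sigmaField {r : ℕ} (f : ℤ → Ω → Fin r → ℝ) (I : Set ℤ) : MeasurableSpace Ω :=
  ⨆ t ∈ I, MeasurableSpace.comap (f t) inferInstance

/-- The `α`-mixing coefficient of `f` at distance `t`. -/
def alphaCoeff (P : Measure Ω) {r : ℕ} (f : ℤ → Ω → Fin r → ℝ) (t : ℕ) : ℝ :=
  sSup {a : ℝ | ∃ (i : ℤ) (A B : Set Ω),
    MeasurableSet[sigmaField f (Set.Iic i)] A ∧ MeasurableSet[sigmaField f (Set.Ici (i + t))] B ∧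
    a = |P.real (A ∩ B) - P.real A * P.real B|}

/-- `∑_{t ≥ 1} α(t)^{1-2/γ}` converges, with sum at most `K`. -/
def CondMixing (P : Measure Ω) {r : ℕ} (f : ℤ → Ω → Fin r → ℝ) (γ K : ℝ) : Prop :=
  Summable (fun t : ℕ => alphaCoeff P f (t + 1) ^ (1 - 2 / γ)) ∧
    ∑' t : ℕ, alphaCoeff P f (t + 1) ^ (1 - 2 / γ) ≤ K

/-- `E|f_{t,i}|^{2γ} < σ_f^{2γ}`, for centred factors. -/
def CondMoment (P : Measure Ω) {r : ℕ} (f : ℤ → Ω → Fin r → ℝ) (n : ℕ) (γ σf : ℝ) : Prop :=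
  ∀ t ∈ Set.Icc (1 : ℤ) n, ∀ i,
    ∫ ω, f t ω i ∂P = 0 ∧
    Integrable (fun ω => |f t ω i| ^ (2 * γ)) P ∧ ∫ ω, |f t ω i| ^ (2 * γ) ∂P < σf ^ (2 * γ)

/-- The noise is serially independent and, given the factor process, it is centred (hence
uncorrelated with the factors, also given any σ-field of past factors), serially uncorrelated, and
has covariances bounded by `σε²`. This holds in particular if the noise process has mean zero,
covariances bounded by `σε²`, is serially independent, and is independent of the factor process. -/
structure CondNoise (P : Measure Ω) {p r : ℕ} (f : ℤ → Ω → Fin r → ℝ) (ε : ℤ → Ω → Fin p → ℝ)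
    (n : ℕ) (σε : ℝ) : Prop where
  indep : iIndepFun (fun t : ℤ => ε t) P
  memLp : ∀ t ∈ Set.Icc (1 : ℤ) n, ∀ i, MemLp (fun ω => ε t ω i) 2 P
  centred : ∀ t ∈ Set.Icc (1 : ℤ) n, ∀ i,
    P[fun ω => ε t ω i | sigmaField f Set.univ] =ᵐ[P] 0
  uncorr : ∀ s ∈ Set.Icc (1 : ℤ) n, ∀ t ∈ Set.Icc (1 : ℤ) n, s ≠ t → ∀ i j,
    P[fun ω => ε s ω i * ε t ω j | sigmaField f Set.univ] =ᵐ[P] 0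
  bounded : ∀ t ∈ Set.Icc (1 : ℤ) n, ∀ i j,
    ∀ᵐ ω ∂P, |(P[fun ω => ε t ω i * ε t ω j | sigmaField f Set.univ]) ω| ≤ σε ^ 2

end Cov

/-- `a ≍ b`: the quotient converges to a positive constant. -/
def AsympEq (a b : ℕ → ℝ) : Prop :=
  ∃ c : ℝ, 0 < c ∧ Tendsto (fun k => a k / b k) atTop (𝓝 c)

/-- Factor strength `δ`, with `m` the number of nonzero loadings, and bounded loadings. -/
structure CondStrength {r : ℕ} (p : ℕ → ℕ) (As : ∀ k, Matrix (Fin (p k)) (Fin r) ℝ)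
    (δ C₁ : ℝ) : Prop where
  specNorm_sq : AsympEq (fun k => specNorm (As k) ^ 2) (fun k => (nnz (As k) : ℝ) ^ (1 - δ))
  minSing_sq : AsympEq (fun k => minSing (As k) ^ 2) (fun k => (nnz (As k) : ℝ) ^ (1 - δ))
  max_le : ∀ k i j, |As k i j| ≤ C₁

/-- `M` has exactly `r` distinct nonzero eigenvalues. -/
def CondEigen {p : ℕ} (r : ℕ) (M : Matrix (Fin p) (Fin p) ℝ) : Prop :=
  {μ : ℝ | μ ≠ 0 ∧ Module.End.HasEigenvalue (Matrix.toLin' M) μ}.ncard = r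

/-- `X_k = O_p(a_k)`. -/
def IsBigOp {Ω : ℕ → Type*} [∀ k, MeasurableSpace (Ω k)] (P : ∀ k, Measure (Ω k))
    (X : ∀ k, Ω k → ℝ) (a : ℕ → ℝ) : Prop :=
  ∀ η : ℝ, 0 < η → ∃ C : ℝ, 0 < C ∧
    ∀ᶠ k in atTop, P k {ω | C * a k < |X k ω|} ≤ ENNReal.ofReal η

/-- The rate `m^{δ-1} p n^{-1/2}`. -/
def rate (m p n : ℕ) (δ : ℝ) : ℝ :=
  (m : ℝ) ^ (δ - 1) * (p : ℝ) * (n : ℝ) ^ (-(1 / 2) : ℝ)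

end FactorModel

end

/-!
At a lag `h ≥ 1` the noise does not contribute to the autocovariance of `x`, so
`Σ_x(h) = Aˢ Σ_f(h) Aˢᵀ`. Hence the column space of `M` is that of `Aˢ`, the matrices `Σ_x(h)` are
of order `q = m ^ (1 - δ)`, and the nonzero eigenvalues of `M` are at least `c ‖Aˢ‖_min⁴`, of order
`q²`. Each sample autocovariance deviates from `Σ_x(h)` by `O_p(p n^(-1/2))` in the Frobenius norm:
for the factor part this is Davydov's inequality with summable mixing coefficients, and the
summands of the noise parts are orthogonal in `L²`. Therefore `M̂ - M = O_p(q p n^(-1/2))`. As `Ŝ`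
maximizes `tr(Tᵀ M̂ T)`, the trace `tr(Tᵀ M T)` is nearly maximal at `T = Ŝ`, and the eigenvalue gap
of `M` turns this into the distance `O_p(q p n^(-1/2) / q²)` of the projections.
-/

namespace FactorModel

/-! ### Second moments -/

section SecondMoment

variable {Ω : Type*} [MeasurableSpace Ω]

/-- The random variable `X` is square integrable with `E X² ≤ B`. All rates of convergence are
obtained from bounds of this form, through Chebyshev's inequality. -/
structure HasSecondMomentLE (P : Measure Ω) (X : Ω → ℝ) (B : ℝ) : Prop where
  memLp : MemLp X 2 P
  integral_sq_le : ∫ ω, X ω ^ 2 ∂P ≤ B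

variable {P : Measure Ω} {X Y : Ω → ℝ} {B B' : ℝ}

theorem HasSecondMomentLE.nonneg (hX : HasSecondMomentLE P X B) : 0 ≤ B :=
  (integral_nonneg fun _ => sq_nonneg _).trans hX.integral_sq_le

theorem HasSecondMomentLE.mono (hX : HasSecondMomentLE P X B) (hB : B ≤ B') :
    HasSecondMomentLE P X B' :=
  ⟨hX.memLp, hX.integral_sq_le.trans hB⟩

theorem HasSecondMomentLE.of_abs_le (hY : HasSecondMomentLE P Y B) (hX : AEStronglyMeasurable X P)
    (hXY : ∀ ω, |X ω| ≤ Y ω) : HasSecondMomentLE P X B where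
  memLp := hY.memLp.mono hX (.of_forall fun ω => (hXY ω).trans (le_abs_self _))
  integral_sq_le := by
    refine (integral_mono_of_nonneg (.of_forall fun ω => sq_nonneg _) hY.memLp.integrable_sq
      (.of_forall fun ω => ?_)).trans hY.integral_sq_le
    exact sq_le_sq.2 ((hXY ω).trans (le_abs_self _))

theorem HasSecondMomentLE.const_mul (hX : HasSecondMomentLE P X B) (a : ℝ) :
    HasSecondMomentLE P (fun ω => a * X ω) (a ^ 2 * B) where
  memLp := hX.memLp.const_mul a
  integral_sq_le := by
    simp only [mul_pow, integral_const_mul]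
    exact mul_le_mul_of_nonneg_left hX.integral_sq_le (sq_nonneg a)

theorem HasSecondMomentLE.sum {ι : Type*} {s : Finset ι} {Z : ι → Ω → ℝ} {b : ι → ℝ}
    (hZ : ∀ i ∈ s, HasSecondMomentLE P (Z i) (b i)) :
    HasSecondMomentLE P (fun ω => ∑ i ∈ s, Z i ω) (s.card * ∑ i ∈ s, b i) where
  memLp := memLp_finsetSum _ fun i hi => (hZ i hi).memLp
  integral_sq_le := calc
    ∫ ω, (∑ i ∈ s, Z i ω) ^ 2 ∂P ≤ ∫ ω, s.card * ∑ i ∈ s, Z i ω ^ 2 ∂P :=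
      integral_mono_of_nonneg (.of_forall fun _ => sq_nonneg _)
        ((integrable_finsetSum _ fun i hi => (hZ i hi).memLp.integrable_sq).const_mul _)
        (.of_forall fun _ => sq_sum_le_card_mul_sum_sq)
    _ = s.card * ∑ i ∈ s, ∫ ω, Z i ω ^ 2 ∂P := by
      rw [integral_const_mul, integral_finsetSum _ fun i hi => (hZ i hi).memLp.integrable_sq]
    _ ≤ s.card * ∑ i ∈ s, b i := by
      gcongr with i hi
      exact (hZ i hi).integral_sq_le

theorem HasSecondMomentLE.add (hX : HasSecondMomentLE P X B) (hY : HasSecondMomentLE P Y B') :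
    HasSecondMomentLE P (fun ω => X ω + Y ω) (2 * (B + B')) := by
  have := HasSecondMomentLE.sum (P := P) (s := Finset.univ) (Z := ![X, Y]) (b := ![B, B'])
    (by simp [Fin.forall_fin_two, hX, hY])
  simpa using this

theorem abs_integral_mul_le_sqrt (hX : MemLp X 2 P) (hY : MemLp Y 2 P) :
    |∫ ω, X ω * Y ω ∂P| ≤ √(∫ ω, X ω ^ 2 ∂P) * √(∫ ω, Y ω ^ 2 ∂P) := by
  have hofReal : ENNReal.ofReal 2 = 2 := by norm_num
  have hHolder := integral_mul_norm_le_Lp_mul_Lq (μ := P) Real.HolderConjugate.two_two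
    (hofReal ▸ hX) (hofReal ▸ hY)
  simp only [Real.norm_eq_abs, Real.rpow_two, sq_abs, ← Real.sqrt_eq_rpow] at hHolder
  refine abs_integral_le_integral_abs.trans (le_of_eq_of_le ?_ hHolder)
  simp only [abs_mul]

theorem HasSecondMomentLE.abs_integral_mul_le (hX : HasSecondMomentLE P X B)
    (hY : HasSecondMomentLE P Y B') : |∫ ω, X ω * Y ω ∂P| ≤ √B * √B' := by
  refine (abs_integral_mul_le_sqrt hX.memLp hY.memLp).trans ?_
  gcongr
  exacts [hX.integral_sq_le, hY.integral_sq_le]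

theorem HasSecondMomentLE.of_integral_rpow_le [IsProbabilityMeasure P] {γ s : ℝ} (hγ : 2 ≤ γ)
    (hs : 0 ≤ s) (hX : AEStronglyMeasurable X P) (hXγ : Integrable (fun ω => |X ω| ^ γ) P)
    (hXs : ∫ ω, |X ω| ^ γ ∂P ≤ s ^ γ) : HasSecondMomentLE P X (s ^ 2) := by
  have hpow (x : ℝ) : (x ^ 2) ^ (γ / 2) = |x| ^ γ := by
    rw [← sq_abs, ← Real.rpow_natCast_mul (abs_nonneg x)]
    congr 1
    push_cast
    ring
  have hLp : MemLp X 2 P := by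
    refine MemLp.mono_exponent (q := ENNReal.ofReal γ) ?_ (by simpa using hγ)
    rw [← integrable_norm_rpow_iff hX (by simpa using by linarith) ENNReal.ofReal_ne_top,
      ENNReal.toReal_ofReal (by linarith)]
    exact hXγ
  refine ⟨hLp, ?_⟩
  have hJensen : (∫ ω, X ω ^ 2 ∂P) ^ (γ / 2) ≤ ∫ ω, (X ω ^ 2) ^ (γ / 2) ∂P :=
    (convexOn_rpow (by linarith)).map_integral_le (Real.continuous_rpow_const
      (by linarith)).continuousOn isClosed_Ici (.of_forall fun ω => sq_nonneg (X ω))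
      hLp.integrable_sq (by simpa only [Function.comp_def, hpow] using hXγ)
  rw [← Real.rpow_le_rpow_iff (integral_nonneg fun ω => sq_nonneg (X ω)) (sq_nonneg s)
    (show 0 < γ / 2 by linarith), hpow, abs_of_nonneg hs]
  simpa only [hpow] using hJensen.trans (by simpa only [hpow] using hXs)

theorem HasSecondMomentLE.measure_lt_abs_le [IsFiniteMeasure P] (hX : HasSecondMomentLE P X B)
    {a : ℝ} (ha : 0 < a) : P {ω | a < |X ω|} ≤ ENNReal.ofReal (B / a ^ 2) := by
  have hMarkov : a ^ 2 * P.real {ω | a ^ 2 ≤ X ω ^ 2} ≤ B :=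
    (mul_meas_ge_le_integral_of_nonneg (.of_forall fun ω => sq_nonneg (X ω))
      hX.memLp.integrable_sq (a ^ 2)).trans hX.integral_sq_le
  calc P {ω | a < |X ω|} ≤ P {ω | a ^ 2 ≤ X ω ^ 2} :=
        measure_mono fun ω (hω : a < |X ω|) =>
          sq_le_sq.2 ((abs_of_pos ha).trans_le hω.le)
    _ = ENNReal.ofReal (P.real {ω | a ^ 2 ≤ X ω ^ 2}) := by simp
    _ ≤ ENNReal.ofReal (B / a ^ 2) := by
        refine ENNReal.ofReal_le_ofReal ((le_div_iff₀ (by positivity)).2 ?_)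
        rwa [mul_comm]

end SecondMoment

theorem isBigOp_of_hasSecondMomentLE {Ω : ℕ → Type*} [∀ k, MeasurableSpace (Ω k)]
    {P : ∀ k, Measure (Ω k)} [∀ k, IsFiniteMeasure (P k)] {X : ∀ k, Ω k → ℝ} {a : ℕ → ℝ} {B : ℝ}
    (ha : ∀ᶠ k in atTop, 0 < a k)
    (hX : ∀ᶠ k in atTop, ∃ Y, (∀ ω, |X k ω| ≤ Y ω) ∧ HasSecondMomentLE (P k) Y (B * a k ^ 2)) :
    IsBigOp P X a := by
  intro η hη
  set C := √((|B| + 1) / η)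
  have hC₀ : 0 < C := Real.sqrt_pos.2 (by positivity)
  have hC₂ : C ^ 2 = (|B| + 1) / η := Real.sq_sqrt (by positivity)
  refine ⟨C, hC₀, ?_⟩
  filter_upwards [ha, hX] with k hak ⟨Y, hXY, hY⟩
  calc P k {ω | C * a k < |X k ω|} ≤ P k {ω | C * a k < |Y ω|} :=
        measure_mono fun ω (hω : C * a k < |X k ω|) =>
          hω.trans_le ((hXY ω).trans (le_abs_self _))
    _ ≤ ENNReal.ofReal (B * a k ^ 2 / (C * a k) ^ 2) := hY.measure_lt_abs_le (by positivity)
    _ ≤ ENNReal.ofReal η := by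
        refine ENNReal.ofReal_le_ofReal ?_
        rw [mul_pow, mul_div_mul_right _ _ (by positivity), div_le_iff₀ (by positivity), hC₂,
          mul_div_cancel₀ _ hη.ne']
        linarith [le_abs_self B]

/-! ### Averages of weakly correlated variables -/

section Average

theorem sum_comp_le_tsum {ι κ : Type*} {b : κ → ℝ} (hb : ∀ d, 0 ≤ b d) (hs : Summable b)
    {I : Finset ι} {φ : ι → κ} (hφ : Set.InjOn φ I) : ∑ t ∈ I, b (φ t) ≤ ∑' d, b d := by
  classical
  rw [← Finset.sum_image hφ]
  exact hs.sum_le_tsum _ fun d _ => hb d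

theorem sum_dist_le_two_mul_tsum {b : ℕ → ℝ} (hb : ∀ d, 0 ≤ b d) (hs : Summable b)
    (I : Finset ℕ) (s : ℕ) : ∑ t ∈ I, b (Nat.dist s t) ≤ 2 * ∑' d, b d := by
  have hInj (p : ℕ → Prop) [DecidablePred p] (hp : (∀ t, p t → s ≤ t) ∨ ∀ t, p t → t ≤ s) :
      Set.InjOn (Nat.dist s) (I.filter p) := by
    intro t ht u hu htu
    simp only [Finset.coe_filter, Set.mem_ofPred_eq] at ht hu
    simp only [Nat.dist] at htu
    rcases hp with hp | hp <;> have := hp t ht.2 <;> have := hp u hu.2 <;> omega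
  rw [← Finset.sum_filter_add_sum_filter_not I (s ≤ ·), two_mul]
  exact add_le_add (sum_comp_le_tsum hb hs (hInj _ (.inl fun _ => id)))
    (sum_comp_le_tsum hb hs (hInj _ (.inr fun _ h => (not_le.1 h).le)))

variable {Ω : Type*} [MeasurableSpace Ω] {P : Measure Ω} {I : Finset ℕ} {Y : ℕ → Ω → ℝ}

theorem hasSecondMomentLE_average {b : ℕ → ℝ} (hY : ∀ t ∈ I, MemLp (Y t) 2 P)
    (hb : ∀ d, 0 ≤ b d) (hs : Summable b)
    (hcov : ∀ s ∈ I, ∀ t ∈ I, s ≤ t → ∫ ω, Y s ω * Y t ω ∂P ≤ b (t - s)) :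
    HasSecondMomentLE P (fun ω => (I.card : ℝ)⁻¹ * ∑ t ∈ I, Y t ω)
      (2 * (∑' d, b d) / I.card) where
  memLp := (memLp_finsetSum _ hY).const_mul _
  integral_sq_le := by
    have hint : ∀ s ∈ I, ∀ t ∈ I, Integrable (fun ω => Y s ω * Y t ω) P :=
      fun s hs t ht => (hY s hs).integrable_mul (hY t ht)
    have hdist : ∀ s ∈ I, ∀ t ∈ I, ∫ ω, Y s ω * Y t ω ∂P ≤ b (Nat.dist s t) := by
      intro s hs t ht
      rcases le_total s t with h | h
      · exact (hcov s hs t ht h).trans_eq (by rw [Nat.dist_eq_sub_of_le h])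
      · simp only [mul_comm (Y s _)]
        exact (hcov t ht s hs h).trans_eq (by rw [Nat.dist_eq_sub_of_le_right h])
    calc ∫ ω, ((I.card : ℝ)⁻¹ * ∑ t ∈ I, Y t ω) ^ 2 ∂P
        = ((I.card : ℝ)⁻¹) ^ 2 * ∑ s ∈ I, ∑ t ∈ I, ∫ ω, Y s ω * Y t ω ∂P := by
          simp only [mul_pow, sq (∑ _ ∈ I, _), Finset.sum_mul_sum]
          rw [integral_const_mul,
            integral_finsetSum _ fun s hs => integrable_finsetSum _ fun t ht => hint s hs t ht]
          congr 1
          exact Finset.sum_congr rfl fun s hs => integral_finsetSum _ fun t ht => hint s hs t ht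
      _ ≤ ((I.card : ℝ)⁻¹) ^ 2 * ∑ s ∈ I, 2 * ∑' d, b d := by
          gcongr with s hs
          exact (Finset.sum_le_sum (hdist s hs)).trans (sum_dist_le_two_mul_tsum hb ‹_› I s)
      _ = 2 * (∑' d, b d) / I.card := by
          rw [Finset.sum_const, nsmul_eq_mul]
          rcases I.card.eq_zero_or_pos with h | h
          · simp [h]
          · field_simp

theorem hasSecondMomentLE_average_of_orthogonal {β : ℝ} (hβ : 0 ≤ β)
    (hY : ∀ t ∈ I, HasSecondMomentLE P (Y t) β)
    (horth : ∀ s ∈ I, ∀ t ∈ I, s < t → ∫ ω, Y s ω * Y t ω ∂P = 0) :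
    HasSecondMomentLE P (fun ω => (I.card : ℝ)⁻¹ * ∑ t ∈ I, Y t ω) (2 * β / I.card) := by
  have hsum := hasSum_pi_single (0 : ℕ) β
  have hnonneg (d : ℕ) : 0 ≤ (Pi.single 0 β : ℕ → ℝ) d := by
    rw [Pi.single_apply]
    split_ifs <;> simp [hβ]
  have h := hasSecondMomentLE_average (b := Pi.single 0 β) (fun t ht => (hY t ht).memLp)
    hnonneg hsum.summable fun s hs t ht hst => ?_
  · rwa [hsum.tsum_eq] at h
  · rcases hst.eq_or_lt with rfl | hlt
    · simpa [← sq] using (hY s hs).integral_sq_le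
    · rw [horth s hs t ht hlt]
      exact hnonneg _

end Average

/-! ### Davydov's covariance inequality -/

section Davydov

variable {Ω : Type*} {m₁ m₂ m₀ : MeasurableSpace Ω} {P : Measure Ω}

/-- The σ-fields `m₁` and `m₂` have strong mixing (`α`-mixing) coefficient at most `α` under `P`. -/
def AlphaMixingWith (m₁ m₂ : MeasurableSpace Ω) {_ : MeasurableSpace Ω} (P : Measure Ω) (α : ℝ) :
    Prop :=
  ∀ A B, MeasurableSet[m₁] A → MeasurableSet[m₂] B → |P.real (A ∩ B) - P.real A * P.real B| ≤ α

theorem AlphaMixingWith.mono {α β : ℝ} (h : AlphaMixingWith m₁ m₂ P α) (hαβ : α ≤ β) :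
    AlphaMixingWith m₁ m₂ P β :=
  fun A B hA hB => (h A B hA hB).trans hαβ

theorem AlphaMixingWith.nonneg {α : ℝ} (h : AlphaMixingWith m₁ m₂ P α) : 0 ≤ α :=
  (abs_nonneg _).trans (h ∅ ∅ (@MeasurableSet.empty _ m₁) (@MeasurableSet.empty _ m₂))

theorem abs_integral_mul_le_of_abs_le {X Z : Ω → ℝ} {a : ℝ} (hX : ∀ ω, |X ω| ≤ a)
    (hZ : Integrable Z P) : |∫ ω, X ω * Z ω ∂P| ≤ a * ∫ ω, |Z ω| ∂P := by
  rw [← integral_const_mul]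
  refine abs_integral_le_integral_abs.trans (integral_mono_of_nonneg
    (.of_forall fun ω => abs_nonneg _) (hZ.abs.const_mul _) (.of_forall fun ω => ?_))
  simp only [abs_mul]
  exact mul_le_mul_of_nonneg_right (hX ω) (abs_nonneg _)

theorem integral_abs_eq_two_mul_setIntegral {Z : Ω → ℝ} (hZ : Integrable Z P)
    (hm : MeasurableSet {ω | 0 ≤ Z ω}) (hZ₀ : ∫ ω, Z ω ∂P = 0) :
    ∫ ω, |Z ω| ∂P = 2 * ∫ ω in {ω | 0 ≤ Z ω}, Z ω ∂P := by
  have habs (ω : Ω) : |Z ω| = 2 * {ω | 0 ≤ Z ω}.indicator Z ω - Z ω := by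
    by_cases h : 0 ≤ Z ω
    · rw [Set.indicator_of_mem (show ω ∈ {ω | 0 ≤ Z ω} from h), abs_of_nonneg h]
      ring
    · rw [Set.indicator_of_notMem (show ω ∉ {ω | 0 ≤ Z ω} from h), abs_of_neg (not_le.1 h)]
      ring
  simp only [habs]
  rw [integral_sub ((hZ.indicator hm).const_mul _) hZ, hZ₀, integral_const_mul,
    integral_indicator hm, sub_zero]

variable {X Y : Ω → ℝ} {a b α γ s t : ℝ}

theorem abs_sub_truncation_rpow_le {q : ℝ} (ha : 0 < a) (hq : 0 < q) (hqγ : q ≤ γ)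
    (X : Ω → ℝ) (ω : Ω) : |X ω - truncation X a ω| ^ q ≤ a ^ (q - γ) * |X ω| ^ γ := by
  rcases lt_or_ge |X ω| a with h | h
  · rw [truncation_eq_self h, sub_self, abs_zero, Real.zero_rpow hq.ne']
    positivity
  · have hX₀ : 0 < |X ω| := ha.trans_le h
    have hle : |X ω - truncation X a ω| ≤ |X ω| := by
      simp only [truncation, Function.comp_apply, Set.indicator]
      split_ifs <;> simp
    calc |X ω - truncation X a ω| ^ q ≤ |X ω| ^ q := by gcongr
      _ = |X ω| ^ (q - γ) * |X ω| ^ γ := by rw [← Real.rpow_add hX₀, sub_add_cancel]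
      _ ≤ a ^ (q - γ) * |X ω| ^ γ := by
        have := Real.rpow_le_rpow_of_nonpos ha h (sub_nonpos.2 hqγ)
        gcongr

theorem integral_abs_sub_truncation_rpow_le {q : ℝ} (hα : 0 < α) (hs : 0 < s) (hq : 0 < q)
    (hqγ : q ≤ γ) (hXγ : Integrable (fun ω => |X ω| ^ γ) P) (hXs : ∫ ω, |X ω| ^ γ ∂P ≤ s ^ γ) :
    ∫ ω, |X ω - truncation X (s * α ^ (-(1 / γ))) ω| ^ q ∂P ≤ s ^ q * α ^ (1 - q / γ) := by
  have hγ : γ ≠ 0 := (hq.trans_le hqγ).ne'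
  set a := s * α ^ (-(1 / γ))
  have ha : 0 < a := by positivity
  calc ∫ ω, |X ω - truncation X a ω| ^ q ∂P ≤ ∫ ω, a ^ (q - γ) * |X ω| ^ γ ∂P :=
        integral_mono_of_nonneg (.of_forall fun ω => by positivity) (hXγ.const_mul _)
          (.of_forall fun ω => abs_sub_truncation_rpow_le ha hq hqγ X ω)
    _ ≤ a ^ (q - γ) * s ^ γ := by
        rw [integral_const_mul]
        gcongr
    _ = (s ^ (q - γ) * s ^ γ) * α ^ (-(1 / γ) * (q - γ)) := by
        rw [Real.mul_rpow hs.le (by positivity), ← Real.rpow_mul hα.le]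
        ring
    _ = s ^ q * α ^ (1 - q / γ) := by
        rw [← Real.rpow_add hs, sub_add_cancel]
        congr 2
        field_simp
        ring

variable [IsProbabilityMeasure P]

theorem covariance_eq_integral_mul_sub (hX : AEStronglyMeasurable X P) (hXa : ∀ ω, |X ω| ≤ a)
    (hY : Integrable Y P) : cov[X, Y; P] = ∫ ω, X ω * (Y ω - P[Y]) ∂P := by
  have hYc : Integrable (fun ω => Y ω - P[Y]) P := hY.sub (integrable_const _)
  simp only [covariance, sub_mul]
  rw [integral_sub (hYc.bdd_mul hX (.of_forall hXa)) (hYc.const_mul _), integral_const_mul,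
    integral_sub hY (integrable_const _)]
  simp

theorem abs_covariance_le_of_abs_le (hX : AEStronglyMeasurable X P) (hXa : ∀ ω, |X ω| ≤ a)
    (hY : Integrable Y P) : |cov[X, Y; P]| ≤ 2 * a * ∫ ω, |Y ω| ∂P := by
  obtain ⟨ω₀⟩ := nonempty_of_isProbabilityMeasure P
  have hcentre : ∫ ω, |Y ω - P[Y]| ∂P ≤ 2 * ∫ ω, |Y ω| ∂P := calc
    ∫ ω, |Y ω - P[Y]| ∂P ≤ ∫ ω, (|Y ω| + |P[Y]|) ∂P :=
      integral_mono (hY.sub (integrable_const _)).abs (hY.abs.add (integrable_const _))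
        fun ω => abs_sub _ _
    _ = ∫ ω, |Y ω| ∂P + |P[Y]| := by
      rw [integral_add hY.abs (integrable_const _)]
      simp
    _ ≤ 2 * ∫ ω, |Y ω| ∂P := by linarith [abs_integral_le_integral_abs (f := Y) (μ := P)]
  calc |cov[X, Y; P]| = |∫ ω, X ω * (Y ω - P[Y]) ∂P| := by
        rw [covariance_eq_integral_mul_sub hX hXa hY]
    _ ≤ a * ∫ ω, |Y ω - P[Y]| ∂P :=
        abs_integral_mul_le_of_abs_le hXa (hY.sub (integrable_const _))
    _ ≤ a * (2 * ∫ ω, |Y ω| ∂P) :=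
        mul_le_mul_of_nonneg_left hcentre ((abs_nonneg _).trans (hXa ω₀))
    _ = 2 * a * ∫ ω, |Y ω| ∂P := by ring

theorem abs_covariance_le_sqrt (hX : MemLp X 2 P) (hY : MemLp Y 2 P) :
    |cov[X, Y; P]| ≤ √(∫ ω, X ω ^ 2 ∂P) * √(∫ ω, Y ω ^ 2 ∂P) := by
  have hvar {Z : Ω → ℝ} (hZ : MemLp Z 2 P) : ∫ ω, (Z ω - P[Z]) ^ 2 ∂P ≤ ∫ ω, Z ω ^ 2 ∂P := by
    rw [← variance_eq_integral hZ.aestronglyMeasurable.aemeasurable]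
    exact variance_le_expectation_sq hZ.aestronglyMeasurable
  exact (abs_integral_mul_le_sqrt (hX.sub (memLp_const _)) (hY.sub (memLp_const _))).trans
    (mul_le_mul (Real.sqrt_le_sqrt (hvar hX)) (Real.sqrt_le_sqrt (hvar hY))
      (Real.sqrt_nonneg _) (Real.sqrt_nonneg _))

theorem covariance_indicator_one {A B : Set Ω} (hA : MeasurableSet A) (hB : MeasurableSet B) :
    cov[A.indicator 1, B.indicator 1; P] = P.real (A ∩ B) - P.real A * P.real B := by
  have hLp {C : Set Ω} (hC : MeasurableSet C) : MemLp (C.indicator (1 : Ω → ℝ)) 2 P :=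
    (memLp_const (1 : ℝ)).indicator hC
  rw [covariance_eq_sub (hLp hA) (hLp hB), ← Set.inter_indicator_one,
    integral_indicator_one hA, integral_indicator_one hB, integral_indicator_one (hA.inter hB)]

-- The extremal choice is the sign of `E[Y | m₁] - E Y`: `A` is the set where this is nonnegative.
theorem exists_abs_covariance_le (hm₁ : m₁ ≤ m₀) (hX : StronglyMeasurable[m₁] X)
    (hXa : ∀ ω, |X ω| ≤ a) (hY : Integrable Y P) :
    ∃ A, MeasurableSet[m₁] A ∧ |cov[X, Y; P]| ≤ 2 * a * cov[A.indicator 1, Y; P] := by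
  set U : Ω → ℝ := fun ω => Y ω - P[Y]
  set Z : Ω → ℝ := P[U | m₁]
  set A : Set Ω := {ω | 0 ≤ Z ω}
  have hU : Integrable U P := hY.sub (integrable_const _)
  have hA : MeasurableSet[m₁] A :=
    measurableSet_le measurable_const stronglyMeasurable_condExp.measurable
  have hX₀ : AEStronglyMeasurable X P := (hX.mono hm₁).aestronglyMeasurable
  have hZ₀ : ∫ ω, Z ω ∂P = 0 := by
    rw [integral_condExp hm₁, integral_sub hY (integrable_const _)]
    simp
  have hcovX : cov[X, Y; P] = ∫ ω, X ω * Z ω ∂P := by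
    rw [covariance_eq_integral_mul_sub hX₀ hXa hY, ← integral_condExp hm₁]
    exact integral_congr_ae
      (condExp_mul_of_stronglyMeasurable_left hX (hU.bdd_mul hX₀ (.of_forall hXa)) hU)
  have hcovA : cov[A.indicator 1, Y; P] = ∫ ω in A, Z ω ∂P := by
    have hA₁ (ω : Ω) : |A.indicator (1 : Ω → ℝ) ω| ≤ 1 := by
      by_cases h : ω ∈ A <;> simp [h]
    rw [covariance_eq_integral_mul_sub
        ((measurable_one.indicator (hm₁ _ hA)).aestronglyMeasurable) hA₁ hY,
      setIntegral_condExp hm₁ hU hA, ← integral_indicator (hm₁ _ hA)]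
    refine integral_congr_ae (.of_forall fun ω => ?_)
    by_cases h : ω ∈ A <;> simp [h, U]
  refine ⟨A, hA, ?_⟩
  rw [hcovX, hcovA, mul_comm 2, mul_assoc,
    ← integral_abs_eq_two_mul_setIntegral integrable_condExp (hm₁ _ hA) hZ₀]
  exact abs_integral_mul_le_of_abs_le hXa integrable_condExp

theorem AlphaMixingWith.abs_covariance_le_of_abs_le (h : AlphaMixingWith m₁ m₂ P α)
    (hm₁ : m₁ ≤ m₀) (hm₂ : m₂ ≤ m₀) (hX : StronglyMeasurable[m₁] X) (hXa : ∀ ω, |X ω| ≤ a)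
    (hY : StronglyMeasurable[m₂] Y) (hYb : ∀ ω, |Y ω| ≤ b) :
    |cov[X, Y; P]| ≤ 4 * α * (a * b) := by
  obtain ⟨ω₀⟩ := nonempty_of_isProbabilityMeasure P
  have ha : 0 ≤ a := (abs_nonneg _).trans (hXa ω₀)
  have hb : 0 ≤ b := (abs_nonneg _).trans (hYb ω₀)
  have hYi : Integrable Y P :=
    .of_bound (hY.mono hm₂).aestronglyMeasurable b (.of_forall hYb)
  obtain ⟨A, hA, hXY⟩ := exists_abs_covariance_le hm₁ hX hXa hYi
  obtain ⟨B, hB, hYA⟩ := exists_abs_covariance_le (P := P) (Y := A.indicator 1) hm₂ hY hYb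
    ((integrable_const (1 : ℝ)).indicator (hm₁ _ hA))
  calc |cov[X, Y; P]| ≤ 2 * a * cov[A.indicator 1, Y; P] := hXY
    _ ≤ 2 * a * |cov[Y, A.indicator 1; P]| := by
        rw [covariance_comm]
        gcongr
        exact le_abs_self _
    _ ≤ 2 * a * (2 * b * cov[B.indicator 1, A.indicator 1; P]) := by gcongr
    _ ≤ 2 * a * (2 * b * α) := by
        rw [covariance_comm, covariance_indicator_one (hm₁ _ hA) (hm₂ _ hB)]
        gcongr
        exact (le_abs_self _).trans (h A B hA hB)
    _ = 4 * α * (a * b) := by ring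

theorem hasSecondMomentLE_sub_truncation (hα : 0 < α) (hs : 0 < s) (hγ : 2 ≤ γ)
    (hX : MemLp X 2 P) (hXγ : Integrable (fun ω => |X ω| ^ γ) P)
    (hXs : ∫ ω, |X ω| ^ γ ∂P ≤ s ^ γ) :
    HasSecondMomentLE P (X - truncation X (s * α ^ (-(1 / γ)))) (s ^ 2 * α ^ (1 - 2 / γ)) where
  memLp := hX.sub hX.aestronglyMeasurable.memLp_truncation
  integral_sq_le := by
    simpa only [Real.rpow_two, sq_abs, Pi.sub_apply] using
      integral_abs_sub_truncation_rpow_le hα hs two_pos hγ hXγ hXs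

theorem stronglyMeasurable_truncation (hX : StronglyMeasurable X) (a : ℝ) :
    StronglyMeasurable (truncation X a) :=
  ((measurable_id.indicator measurableSet_Ioc).comp hX.measurable).stronglyMeasurable

theorem covariance_eq_add_four {X' Y' : Ω → ℝ} (hX : MemLp X 2 P) (hY : MemLp Y 2 P)
    (hX' : MemLp X' 2 P) (hY' : MemLp Y' 2 P) :
    cov[X, Y; P] = cov[X', Y'; P] + cov[X', Y - Y'; P] + cov[X - X', Y'; P]
      + cov[X - X', Y - Y'; P] := by
  rw [covariance_sub_right hX' hY hY', covariance_sub_left hX hX' hY',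
    covariance_sub_left hX hX' (hY.sub hY'), covariance_sub_right hX hY hY',
    covariance_sub_right hX' hY hY']
  ring

theorem abs_covariance_sub_truncation_le (hα : 0 < α) (hs : 0 ≤ s) (ht : 0 < t) (hγ : 2 ≤ γ)
    (hX : AEStronglyMeasurable X P) (hXs : ∀ ω, |X ω| ≤ s * α ^ (-(1 / γ))) (hY : MemLp Y 2 P)
    (hYγ : Integrable (fun ω => |Y ω| ^ γ) P) (hYt : ∫ ω, |Y ω| ^ γ ∂P ≤ t ^ γ) :
    |cov[X, Y - truncation Y (t * α ^ (-(1 / γ))); P]| ≤ 2 * (s * t) * α ^ (1 - 2 / γ) := by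
  have htail := integral_abs_sub_truncation_rpow_le hα ht one_pos (by linarith) hYγ hYt
  simp only [Real.rpow_one] at htail
  calc |cov[X, Y - truncation Y (t * α ^ (-(1 / γ))); P]|
      ≤ 2 * (s * α ^ (-(1 / γ))) * (t * α ^ (1 - 1 / γ)) := by
        refine (abs_covariance_le_of_abs_le hX hXs
          ((hY.sub hY.aestronglyMeasurable.memLp_truncation).integrable one_le_two)).trans ?_
        gcongr
        exact htail
    _ = 2 * (s * t) * (α ^ (-(1 / γ)) * α ^ (1 - 1 / γ)) := by ring
    _ = 2 * (s * t) * α ^ (1 - 2 / γ) := by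
        rw [← Real.rpow_add hα]
        congr 2
        ring

theorem AlphaMixingWith.abs_covariance_truncation_le (h : AlphaMixingWith m₁ m₂ P α)
    (hm₁ : m₁ ≤ m₀) (hm₂ : m₂ ≤ m₀) (hα : 0 < α) (hs : 0 ≤ s) (ht : 0 ≤ t)
    (hX : StronglyMeasurable[m₁] X) (hY : StronglyMeasurable[m₂] Y) :
    |cov[truncation X (s * α ^ (-(1 / γ))), truncation Y (t * α ^ (-(1 / γ))); P]|
      ≤ 4 * (s * t) * α ^ (1 - 2 / γ) := by
  have hbound {Z : Ω → ℝ} {u : ℝ} (hu : 0 ≤ u) (ω : Ω) :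
      |truncation Z (u * α ^ (-(1 / γ))) ω| ≤ u * α ^ (-(1 / γ)) :=
    (abs_truncation_le_bound Z _ ω).trans_eq (abs_of_nonneg (by positivity))
  calc _ ≤ 4 * α * ((s * α ^ (-(1 / γ))) * (t * α ^ (-(1 / γ)))) :=
        h.abs_covariance_le_of_abs_le hm₁ hm₂ (stronglyMeasurable_truncation hX _) (hbound hs)
          (stronglyMeasurable_truncation hY _) (hbound ht)
    _ = 4 * (s * t) * (α ^ (1 : ℝ) * α ^ (-(1 / γ)) * α ^ (-(1 / γ))) := by
        rw [Real.rpow_one]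
        ring
    _ = 4 * (s * t) * α ^ (1 - 2 / γ) := by
        rw [← Real.rpow_add hα, ← Real.rpow_add hα]
        congr 2
        ring

theorem AlphaMixingWith.abs_covariance_le_of_pos (h : AlphaMixingWith m₁ m₂ P α)
    (hm₁ : m₁ ≤ m₀) (hm₂ : m₂ ≤ m₀) (hα : 0 < α) (hγ : 2 ≤ γ) (hs : 0 < s) (ht : 0 < t)
    (hX : StronglyMeasurable[m₁] X) (hY : StronglyMeasurable[m₂] Y)
    (hXγ : Integrable (fun ω => |X ω| ^ γ) P) (hXs : ∫ ω, |X ω| ^ γ ∂P ≤ s ^ γ)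
    (hYγ : Integrable (fun ω => |Y ω| ^ γ) P) (hYt : ∫ ω, |Y ω| ^ γ ∂P ≤ t ^ γ) :
    |cov[X, Y; P]| ≤ 9 * (s * t) * α ^ (1 - 2 / γ) := by
  set τ := α ^ (1 - 2 / γ)
  have hX₂ := (HasSecondMomentLE.of_integral_rpow_le hγ hs.le
    (hX.mono hm₁).aestronglyMeasurable hXγ hXs).memLp
  have hY₂ := (HasSecondMomentLE.of_integral_rpow_le hγ ht.le
    (hY.mono hm₂).aestronglyMeasurable hYγ hYt).memLp
  set X' := truncation X (s * α ^ (-(1 / γ)))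
  set Y' := truncation Y (t * α ^ (-(1 / γ)))
  have hbound {Z : Ω → ℝ} {u : ℝ} (hu : 0 < u) (ω : Ω) :
      |truncation Z (u * α ^ (-(1 / γ))) ω| ≤ u * α ^ (-(1 / γ)) :=
    (abs_truncation_le_bound Z _ ω).trans_eq (abs_of_pos (by positivity))
  have hX'₂ : MemLp X' 2 P := hX₂.aestronglyMeasurable.memLp_truncation
  have hY'₂ : MemLp Y' 2 P := hY₂.aestronglyMeasurable.memLp_truncation
  have hbulk : |cov[X', Y'; P]| ≤ 4 * (s * t) * τ :=
    h.abs_covariance_truncation_le hm₁ hm₂ hα hs.le ht.le hX hY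
  have htailY : |cov[X', Y - Y'; P]| ≤ 2 * (s * t) * τ :=
    abs_covariance_sub_truncation_le hα hs.le ht hγ hX'₂.aestronglyMeasurable (hbound hs) hY₂
      hYγ hYt
  have htailX : |cov[X - X', Y'; P]| ≤ 2 * (s * t) * τ := by
    rw [covariance_comm, mul_comm s]
    exact abs_covariance_sub_truncation_le hα ht.le hs hγ hY'₂.aestronglyMeasurable (hbound ht)
      hX₂ hXγ hXs
  have htails : |cov[X - X', Y - Y'; P]| ≤ (s * t) * τ := calc
    |cov[X - X', Y - Y'; P]| ≤ √(s ^ 2 * τ) * √(t ^ 2 * τ) := by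
      refine (abs_covariance_le_sqrt (hX₂.sub hX'₂) (hY₂.sub hY'₂)).trans ?_
      gcongr
      exacts [(hasSecondMomentLE_sub_truncation hα hs hγ hX₂ hXγ hXs).integral_sq_le,
        (hasSecondMomentLE_sub_truncation hα ht hγ hY₂ hYγ hYt).integral_sq_le]
    _ = s * t * τ := by
      rw [← Real.sqrt_mul (by positivity), show s ^ 2 * τ * (t ^ 2 * τ) = (s * t * τ) ^ 2 by ring,
        Real.sqrt_sq (by positivity)]
  rw [covariance_eq_add_four hX₂ hY₂ hX'₂ hY'₂]
  simp only [abs_le] at hbulk htailY htailX htails ⊢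
  constructor <;> linarith

theorem AlphaMixingWith.abs_covariance_le (h : AlphaMixingWith m₁ m₂ P α)
    (hm₁ : m₁ ≤ m₀) (hm₂ : m₂ ≤ m₀) (hγ : 2 < γ) (hs : 0 < s) (ht : 0 < t)
    (hX : StronglyMeasurable[m₁] X) (hY : StronglyMeasurable[m₂] Y)
    (hXγ : Integrable (fun ω => |X ω| ^ γ) P) (hXs : ∫ ω, |X ω| ^ γ ∂P ≤ s ^ γ)
    (hYγ : Integrable (fun ω => |Y ω| ^ γ) P) (hYt : ∫ ω, |Y ω| ^ γ ∂P ≤ t ^ γ) :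
    |cov[X, Y; P]| ≤ 9 * (s * t) * α ^ (1 - 2 / γ) := by
  have he : 0 < 1 - 2 / γ := sub_pos.2 ((div_lt_one (by linarith)).2 hγ)
  have hlim : Tendsto (fun β : ℝ => 9 * (s * t) * β ^ (1 - 2 / γ)) (𝓝[>] α)
      (𝓝 (9 * (s * t) * α ^ (1 - 2 / γ))) :=
    (((Real.continuous_rpow_const he.le).tendsto α).mono_left nhdsWithin_le_nhds).const_mul _
  refine ge_of_tendsto hlim (eventually_mem_nhdsWithin.mono fun β (hβ : α < β) => ?_)
  exact (h.mono hβ.le).abs_covariance_le_of_pos hm₁ hm₂ (h.nonneg.trans_lt hβ) hγ.le hs ht hX hY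
    hXγ hXs hYγ hYt

end Davydov

/-! ### Sample autocovariances of mixing factors -/

section Factors

theorem measurable_sigmaField {Ω : Type*} {r : ℕ} {f : ℤ → Ω → Fin r → ℝ} {I : Set ℤ} {t : ℤ}
    (ht : t ∈ I) (i : Fin r) : Measurable[sigmaField f I] (fun ω => f t ω i) :=
  (measurable_pi_apply i).comp
    ((comap_measurable (f t)).mono (le_iSup₂_of_le t ht le_rfl) le_rfl)

variable {Ω : Type*} [mΩ : MeasurableSpace Ω] {P : Measure Ω} {r n h : ℕ}
  {f : ℤ → Ω → Fin r → ℝ} {γ K σf : ℝ}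

theorem sigmaField_le (hf : ∀ t, Measurable (f t)) (I : Set ℤ) : sigmaField f I ≤ mΩ :=
  iSup₂_le fun t _ => (hf t).comap_le

theorem abs_measureReal_inter_sub_le_one [IsProbabilityMeasure P] (A B : Set Ω) :
    |P.real (A ∩ B) - P.real A * P.real B| ≤ 1 :=
  abs_sub_le_of_nonneg_of_le measureReal_nonneg measureReal_le_one (by positivity)
    (mul_le_one₀ measureReal_le_one measureReal_nonneg measureReal_le_one)

theorem alphaMixingWith_alphaCoeff [IsProbabilityMeasure P] (f : ℤ → Ω → Fin r → ℝ) (i : ℤ)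
    (t : ℕ) : AlphaMixingWith (sigmaField f (Set.Iic i)) (sigmaField f (Set.Ici (i + t))) P
      (alphaCoeff P f t) := by
  intro A B hA hB
  refine le_csSup ⟨1, ?_⟩ ⟨i, A, B, hA, hB, rfl⟩
  rintro a ⟨i, A, B, -, -, rfl⟩
  exact abs_measureReal_inter_sub_le_one A B

theorem alphaCoeff_nonneg (P : Measure Ω) (f : ℤ → Ω → Fin r → ℝ) (t : ℕ) :
    0 ≤ alphaCoeff P f t := by
  refine Real.sSup_nonneg ?_
  rintro a ⟨i, A, B, -, -, rfl⟩
  exact abs_nonneg _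

theorem CondMixing.nonneg (hmix : CondMixing P f γ K) : 0 ≤ K :=
  (tsum_nonneg fun _ => Real.rpow_nonneg (alphaCoeff_nonneg P f _) _).trans hmix.2

theorem CondMoment.hasSecondMomentLE [IsProbabilityMeasure P] (hmom : CondMoment P f n γ σf)
    (hγ : 1 ≤ γ) (hσf : 0 ≤ σf) (hf : ∀ t, Measurable (f t)) {t : ℤ}
    (ht : t ∈ Set.Icc (1 : ℤ) n) (i : Fin r) :
    HasSecondMomentLE P (fun ω => f t ω i) (σf ^ 2) := by
  obtain ⟨-, hint, hlt⟩ := hmom t ht i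
  exact .of_integral_rpow_le (by linarith) hσf
    ((measurable_pi_apply i).comp (hf t)).aestronglyMeasurable hint hlt.le

theorem abs_mul_rpow_le_half_add (a b γ : ℝ) :
    |a * b| ^ γ ≤ 1 / 2 * (|a| ^ (2 * γ) + |b| ^ (2 * γ)) := by
  rw [abs_mul, Real.mul_rpow (abs_nonneg _) (abs_nonneg _), mul_comm 2 γ,
    Real.rpow_mul (abs_nonneg _), Real.rpow_mul (abs_nonneg _), Real.rpow_two, Real.rpow_two]
  linarith [two_mul_le_add_sq (|a| ^ γ) (|b| ^ γ)]

theorem CondMoment.integral_abs_mul_rpow_le (hmom : CondMoment P f n γ σf) (hσf : 0 ≤ σf)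
    (hf : ∀ t, Measurable (f t)) {s t : ℤ} (hs : s ∈ Set.Icc (1 : ℤ) n)
    (ht : t ∈ Set.Icc (1 : ℤ) n) (i j : Fin r) :
    Integrable (fun ω => |f s ω i * f t ω j| ^ γ) P ∧
      ∫ ω, |f s ω i * f t ω j| ^ γ ∂P ≤ (σf ^ 2) ^ γ := by
  obtain ⟨-, hsi, hslt⟩ := hmom s hs i
  obtain ⟨-, htj, htlt⟩ := hmom t ht j
  have hdom := (hsi.add htj).const_mul (1 / 2)
  have hmeas : Measurable fun ω => f s ω i * f t ω j :=
    ((measurable_pi_apply i).comp (hf s)).mul ((measurable_pi_apply j).comp (hf t))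
  have hint : Integrable (fun ω => |f s ω i * f t ω j| ^ γ) P :=
    hdom.mono' (hmeas.abs.pow_const γ).aestronglyMeasurable (.of_forall fun ω => by
      rw [Real.norm_of_nonneg (by positivity)]
      exact abs_mul_rpow_le_half_add _ _ _)
  refine ⟨hint, ?_⟩
  calc ∫ ω, |f s ω i * f t ω j| ^ γ ∂P
      ≤ ∫ ω, 1 / 2 * (|f s ω i| ^ (2 * γ) + |f t ω j| ^ (2 * γ)) ∂P :=
        integral_mono hint hdom fun ω => abs_mul_rpow_le_half_add _ _ _
    _ = 1 / 2 * (∫ ω, |f s ω i| ^ (2 * γ) ∂P + ∫ ω, |f t ω j| ^ (2 * γ) ∂P) := by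
        rw [integral_const_mul, integral_add hsi htj]
    _ ≤ σf ^ (2 * γ) := by linarith
    _ = (σf ^ 2) ^ γ := by
        rw [← Real.rpow_natCast_mul hσf]
        push_cast
        rfl

theorem CondMoment.hasSecondMomentLE_mul [IsProbabilityMeasure P] (hmom : CondMoment P f n γ σf)
    (hγ : 2 ≤ γ) (hσf : 0 ≤ σf) (hf : ∀ t, Measurable (f t)) {s t : ℤ}
    (hs : s ∈ Set.Icc (1 : ℤ) n) (ht : t ∈ Set.Icc (1 : ℤ) n) (i j : Fin r) :
    HasSecondMomentLE P (fun ω => f s ω i * f t ω j) ((σf ^ 2) ^ 2) := by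
  obtain ⟨hint, hle⟩ := hmom.integral_abs_mul_rpow_le hσf hf hs ht i j
  exact .of_integral_rpow_le hγ (sq_nonneg σf) (((measurable_pi_apply i).comp (hf s)).mul
    ((measurable_pi_apply j).comp (hf t))).aestronglyMeasurable hint hle

theorem mem_Icc_of_mem_window {t : ℕ} (ht : t ∈ Finset.Icc 1 (n - h)) :
    (t : ℤ) ∈ Set.Icc (1 : ℤ) n ∧ (t : ℤ) + h ∈ Set.Icc (1 : ℤ) n := by
  rw [Finset.mem_Icc] at ht
  simp only [Set.mem_Icc]
  omega

/-- The bound on the covariance of two products of factors `f_s f_{s+h}` and `f_t f_{t+h}` with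
`t = s + d`: the windows overlap for `d ≤ h`, and their gap is `d - h` otherwise. -/
noncomputable def lagCovBound (P : Measure Ω) (f : ℤ → Ω → Fin r → ℝ) (γ σf : ℝ) (h d : ℕ) : ℝ :=
  if d ≤ h then (σf ^ 2) ^ 2
  else 9 * (σf ^ 2 * σf ^ 2) * alphaCoeff P f (d - h) ^ (1 - 2 / γ)

theorem lagCovBound_nonneg (P : Measure Ω) (f : ℤ → Ω → Fin r → ℝ) (γ σf : ℝ) (h d : ℕ) :
    0 ≤ lagCovBound P f γ σf h d := by
  have := alphaCoeff_nonneg P f (d - h)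
  rw [lagCovBound]
  split_ifs <;> positivity

theorem lagCovBound_add (P : Measure Ω) (f : ℤ → Ω → Fin r → ℝ) (γ σf : ℝ) (h t : ℕ) :
    lagCovBound P f γ σf h (t + (h + 1))
      = 9 * (σf ^ 2 * σf ^ 2) * alphaCoeff P f (t + 1) ^ (1 - 2 / γ) := by
  rw [lagCovBound, if_neg (by omega), show t + (h + 1) - h = t + 1 by omega]

theorem CondMixing.summable_lagCovBound (hmix : CondMixing P f γ K) (σf : ℝ) (h : ℕ) :
    Summable (lagCovBound P f γ σf h) := by
  rw [← summable_nat_add_iff (h + 1)]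
  simpa only [lagCovBound_add] using hmix.1.mul_left _

theorem CondMixing.tsum_lagCovBound_le (hmix : CondMixing P f γ K) (σf : ℝ) (h : ℕ) :
    ∑' d, lagCovBound P f γ σf h d ≤ (h + 1 + 9 * K) * σf ^ 4 := by
  have hhead : ∑ d ∈ Finset.range (h + 1), lagCovBound P f γ σf h d = (h + 1) * (σf ^ 2) ^ 2 := by
    rw [Finset.sum_congr rfl fun d hd =>
      show lagCovBound P f γ σf h d = (σf ^ 2) ^ 2 from
        if_pos (Nat.lt_succ_iff.1 (Finset.mem_range.1 hd)),
      Finset.sum_const, Finset.card_range, nsmul_eq_mul, Nat.cast_succ]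
  rw [← (hmix.summable_lagCovBound σf h).sum_add_tsum_nat_add (h + 1), hhead]
  simp only [lagCovBound_add, tsum_mul_left]
  nlinarith [mul_le_mul_of_nonneg_left hmix.2 (show 0 ≤ 9 * (σf ^ 2 * σf ^ 2) by positivity)]

variable [IsProbabilityMeasure P]

theorem covariance_lag_mul_le (hγ : 2 < γ) (hσf : 0 < σf) (hf : ∀ t, Measurable (f t))
    (hmom : CondMoment P f n γ σf) (i j : Fin r) {s t : ℕ} (hs : s ∈ Finset.Icc 1 (n - h))
    (ht : t ∈ Finset.Icc 1 (n - h)) (hst : s ≤ t) :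
    cov[fun ω => f s ω i * f (s + h) ω j, fun ω => f t ω i * f (t + h) ω j; P]
      ≤ lagCovBound P f γ σf h (t - s) := by
  obtain ⟨hs₁, hs₂⟩ := mem_Icc_of_mem_window hs
  obtain ⟨ht₁, ht₂⟩ := mem_Icc_of_mem_window ht
  have hsm := hmom.hasSecondMomentLE_mul hγ.le hσf.le hf hs₁ hs₂ i j
  have htm := hmom.hasSecondMomentLE_mul hγ.le hσf.le hf ht₁ ht₂ i j
  refine (le_abs_self _).trans ?_
  rw [lagCovBound]
  split_ifs with hd
  · refine (abs_covariance_le_sqrt hsm.memLp htm.memLp).trans ?_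
    rw [← Real.mul_self_sqrt (sq_nonneg (σf ^ 2))]
    gcongr
    exacts [hsm.integral_sq_le, htm.integral_sq_le]
  · obtain ⟨hsi, hsle⟩ := hmom.integral_abs_mul_rpow_le hσf.le hf hs₁ hs₂ i j
    obtain ⟨hti, htle⟩ := hmom.integral_abs_mul_rpow_le hσf.le hf ht₁ ht₂ i j
    have hgap : (s : ℤ) + h + (t - s - h : ℕ) ≤ t := by omega
    refine (alphaMixingWith_alphaCoeff f (s + h) (t - s - h)).abs_covariance_le
      (sigmaField_le hf _) (sigmaField_le hf _) hγ (by positivity) (by positivity)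
      (Measurable.stronglyMeasurable ?_) (Measurable.stronglyMeasurable ?_) hsi hsle hti htle
    · exact (measurable_sigmaField (by simp) i).mul (measurable_sigmaField (by simp) j)
    · exact (measurable_sigmaField (Set.mem_Ici.2 hgap) i).mul
        (measurable_sigmaField (Set.mem_Ici.2 (by omega)) j)

theorem hasSecondMomentLE_factor_average (hγ : 2 < γ) (hσf : 0 < σf) (hf : ∀ t, Measurable (f t))
    (hmix : CondMixing P f γ K) (hmom : CondMoment P f n γ σf) (i j : Fin r) (h : ℕ) :
    HasSecondMomentLE P
      (fun ω => ((Finset.Icc 1 (n - h)).card : ℝ)⁻¹ * ∑ t ∈ Finset.Icc 1 (n - h),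
        (f t ω i * f (t + h) ω j - ∫ ω', f t ω' i * f (t + h) ω' j ∂P))
      (2 * ((h + 1 + 9 * K) * σf ^ 4) / (Finset.Icc 1 (n - h)).card) := by
  refine (hasSecondMomentLE_average (b := lagCovBound P f γ σf h) (fun t ht => ?_)
    (lagCovBound_nonneg P f γ σf h) (hmix.summable_lagCovBound σf h) fun s hs t ht hst =>
      covariance_lag_mul_le hγ hσf hf hmom i j hs ht hst).mono ?_
  · obtain ⟨ht₁, ht₂⟩ := mem_Icc_of_mem_window ht
    exact (hmom.hasSecondMomentLE_mul hγ.le hσf.le hf ht₁ ht₂ i j).memLp.sub (memLp_const _)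
  · gcongr
    exact hmix.tsum_lagCovBound_le σf h

end Factors

/-! ### Averages of products with the noise -/

section CondExp

variable {Ω : Type*} {m m₀ : MeasurableSpace Ω} {P : Measure Ω} [IsFiniteMeasure P] {g e : Ω → ℝ}
  {B c : ℝ}

-- A bound on `P[Z | m]` is a comparison of the measures `Z • P` and `c • P` on `m`.
theorem lintegral_mul_le_of_condExp_le (hm : m ≤ m₀) {g : Ω → ENNReal} (hg : Measurable[m] g)
    {Z : Ω → ℝ} (hZm : Measurable Z) (hZ : Integrable Z P) (hZ₀ : ∀ ω, 0 ≤ Z ω)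
    (hc : ∀ᵐ ω ∂P, (P[Z | m]) ω ≤ c) :
    ∫⁻ ω, ENNReal.ofReal (Z ω) * g ω ∂P ≤ ENNReal.ofReal c * ∫⁻ ω, g ω ∂P := by
  have hle : (P.withDensity fun ω => ENNReal.ofReal (Z ω)).trim hm
      ≤ (ENNReal.ofReal c • P).trim hm := by
    refine Measure.le_iff.2 fun A hA => ?_
    have hA' : ∫ ω in A, (P[Z | m]) ω ∂P ≤ P.real A * c :=
      (integral_mono_ae integrable_condExp.integrableOn (integrable_const _)
        (ae_restrict_of_ae hc)).trans_eq (by rw [setIntegral_const, smul_eq_mul])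
    rw [trim_measurableSet_eq hm hA, trim_measurableSet_eq hm hA, withDensity_apply _ (hm _ hA),
      Measure.smul_apply, smul_eq_mul,
      ← ofReal_integral_eq_lintegral_ofReal hZ.integrableOn (.of_forall hZ₀),
      ← setIntegral_condExp hm hZ hA]
    refine (ENNReal.ofReal_le_ofReal hA').trans_eq ?_
    rw [ENNReal.ofReal_mul measureReal_nonneg, ofReal_measureReal, mul_comm]
  have hint := lintegral_mono' hle (le_refl g)
  rwa [lintegral_trim hm hg, lintegral_trim hm hg,
    lintegral_withDensity_eq_lintegral_mul _ hZm.ennreal_ofReal (hg.mono hm le_rfl),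
    lintegral_smul_measure] at hint

theorem HasSecondMomentLE.mul_of_condExp_le (hg : HasSecondMomentLE P g B) (hm : m ≤ m₀)
    (hgm : Measurable[m] g) (hem : Measurable e) (he : MemLp e 2 P) (hc₀ : 0 ≤ c)
    (hc : ∀ᵐ ω ∂P, (P[fun ω => e ω * e ω | m]) ω ≤ c) :
    HasSecondMomentLE P (fun ω => g ω * e ω) (c * B) := by
  have hmeas : Measurable fun ω => g ω * e ω := (hgm.mono hm le_rfl).mul hem
  have hofReal (ω : Ω) : ENNReal.ofReal ((g ω * e ω) ^ 2)
      = ENNReal.ofReal (e ω * e ω) * ENNReal.ofReal (g ω ^ 2) := by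
    rw [← ENNReal.ofReal_mul (mul_self_nonneg _)]
    congr 1
    ring
  have hlint : ∫⁻ ω, ENNReal.ofReal ((g ω * e ω) ^ 2) ∂P ≤ ENNReal.ofReal (c * B) := calc
    _ ≤ ENNReal.ofReal c * ∫⁻ ω, ENNReal.ofReal (g ω ^ 2) ∂P := by
      simp only [hofReal]
      exact lintegral_mul_le_of_condExp_le hm (hgm.pow_const 2).ennreal_ofReal (hem.mul hem)
        (he.integrable_mul he) (fun ω => mul_self_nonneg _) hc
    _ ≤ ENNReal.ofReal (c * B) := by
      rw [ENNReal.ofReal_mul hc₀, ← ofReal_integral_eq_lintegral_ofReal hg.memLp.integrable_sq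
        (.of_forall fun ω => sq_nonneg _)]
      gcongr
      exact hg.integral_sq_le
  have hsq : Integrable (fun ω => (g ω * e ω) ^ 2) P := by
    refine ⟨(hmeas.pow_const 2).aestronglyMeasurable, ?_⟩
    rw [hasFiniteIntegral_iff_ofReal (.of_forall fun ω => sq_nonneg _)]
    exact hlint.trans_lt ENNReal.ofReal_lt_top
  refine ⟨(memLp_two_iff_integrable_sq hmeas.aestronglyMeasurable).2 hsq, ?_⟩
  rwa [← ofReal_integral_eq_lintegral_ofReal hsq (.of_forall fun ω => sq_nonneg _),
    ENNReal.ofReal_le_ofReal_iff (mul_nonneg hc₀ hg.nonneg)] at hlint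

theorem integral_eq_zero_of_condExp_eq_zero (hm : m ≤ m₀) (h₀ : P[e | m] =ᵐ[P] 0) :
    ∫ ω, e ω ∂P = 0 := by
  rw [← integral_condExp hm, integral_congr_ae h₀]
  simp

theorem integral_mul_eq_zero_of_condExp_eq_zero (hm : m ≤ m₀) (hg : Measurable[m] g)
    (he : Integrable e P) (hge : Integrable (fun ω => g ω * e ω) P) (h₀ : P[e | m] =ᵐ[P] 0) :
    ∫ ω, g ω * e ω ∂P = 0 := by
  refine integral_eq_zero_of_condExp_eq_zero hm
    ((condExp_mul_of_stronglyMeasurable_left hg.stronglyMeasurable hge he).trans ?_)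
  filter_upwards [h₀] with ω hω
  simp [hω]

end CondExp

section Noise

variable {Ω : Type*} [MeasurableSpace Ω] {P : Measure Ω} [IsProbabilityMeasure P] {p r n h : ℕ}
  {f : ℤ → Ω → Fin r → ℝ} {ε : ℤ → Ω → Fin p → ℝ} {γ σf σε : ℝ}

theorem CondNoise.hasSecondMomentLE (hN : CondNoise P f ε n σε) (hf : ∀ t, Measurable (f t))
    {t : ℤ} (ht : t ∈ Set.Icc (1 : ℤ) n) (i : Fin p) :
    HasSecondMomentLE P (fun ω => ε t ω i) (σε ^ 2) where
  memLp := hN.memLp t ht i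
  integral_sq_le := by
    have hmono := integral_mono_ae integrable_condExp (integrable_const (σε ^ 2))
      ((hN.bounded t ht i i).mono fun _ hω => (le_abs_self _).trans hω)
    rw [integral_condExp (sigmaField_le hf Set.univ)] at hmono
    simpa only [← sq, integral_const, probReal_univ, one_smul] using hmono

theorem CondNoise.hasSecondMomentLE_factor_mul (hN : CondNoise P f ε n σε)
    (hf : ∀ t, Measurable (f t)) (hε : ∀ t, Measurable (ε t)) (hγ : 1 ≤ γ) (hσf : 0 ≤ σf)
    (hmom : CondMoment P f n γ σf) {s t : ℤ} (hs : s ∈ Set.Icc (1 : ℤ) n)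
    (ht : t ∈ Set.Icc (1 : ℤ) n) (i : Fin r) (j : Fin p) :
    HasSecondMomentLE P (fun ω => f s ω i * ε t ω j) (σε ^ 2 * σf ^ 2) :=
  (hmom.hasSecondMomentLE hγ hσf hf hs i).mul_of_condExp_le (sigmaField_le hf Set.univ)
    (measurable_sigmaField (Set.mem_univ s) i) ((measurable_pi_apply j).comp (hε t))
    (hN.memLp t ht j) (sq_nonneg σε)
    ((hN.bounded t ht j j).mono fun _ hω => (le_abs_self _).trans hω)

theorem CondNoise.integral_factor_mul_eq_zero (hN : CondNoise P f ε n σε)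
    (hf : ∀ t, Measurable (f t)) (hγ : 1 ≤ γ) (hσf : 0 ≤ σf) (hmom : CondMoment P f n γ σf)
    {s t : ℤ} (hs : s ∈ Set.Icc (1 : ℤ) n) (ht : t ∈ Set.Icc (1 : ℤ) n) (i : Fin r) (j : Fin p) :
    ∫ ω, f s ω i * ε t ω j ∂P = 0 :=
  integral_mul_eq_zero_of_condExp_eq_zero (sigmaField_le hf Set.univ)
    (measurable_sigmaField (Set.mem_univ s) i) ((hN.memLp t ht j).integrable one_le_two)
    ((hmom.hasSecondMomentLE hγ hσf hf hs i).memLp.integrable_mul (hN.memLp t ht j))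
    (hN.centred t ht j)

theorem CondNoise.integral_noise_mul_eq_zero (hN : CondNoise P f ε n σε)
    (hf : ∀ t, Measurable (f t)) {s t : ℤ} (hs : s ∈ Set.Icc (1 : ℤ) n)
    (ht : t ∈ Set.Icc (1 : ℤ) n) (hst : s ≠ t) (i j : Fin p) :
    ∫ ω, ε s ω i * ε t ω j ∂P = 0 :=
  integral_eq_zero_of_condExp_eq_zero (sigmaField_le hf Set.univ) (hN.uncorr s hs t ht hst i j)

theorem hasSecondMomentLE_factor_noise_average (hN : CondNoise P f ε n σε)
    (hf : ∀ t, Measurable (f t)) (hε : ∀ t, Measurable (ε t)) (hγ : 1 ≤ γ) (hσf : 0 ≤ σf)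
    (hmom : CondMoment P f n γ σf) {I : Finset ℕ} {a b : ℕ → ℤ}
    (ha : ∀ t ∈ I, a t ∈ Set.Icc (1 : ℤ) n) (hb : ∀ t ∈ I, b t ∈ Set.Icc (1 : ℤ) n)
    (hinj : Function.Injective b) (i : Fin r) (j : Fin p) :
    HasSecondMomentLE P (fun ω => (I.card : ℝ)⁻¹ * ∑ t ∈ I, f (a t) ω i * ε (b t) ω j)
      (2 * (σε ^ 2 * σf ^ 2) / I.card) := by
  have hterm : ∀ t ∈ I, HasSecondMomentLE P (fun ω => f (a t) ω i * ε (b t) ω j)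
      (σε ^ 2 * σf ^ 2) :=
    fun t ht => hN.hasSecondMomentLE_factor_mul hf hε hγ hσf hmom (ha t ht) (hb t ht) i j
  refine hasSecondMomentLE_average_of_orthogonal (by positivity) hterm fun s hs t ht hst => ?_
  have hint := (hterm s hs).memLp.integrable_mul (hterm t ht).memLp
  simp only [mul_mul_mul_comm (f (a s) _ i), Pi.mul_def] at hint ⊢
  exact integral_mul_eq_zero_of_condExp_eq_zero (sigmaField_le hf Set.univ)
    ((measurable_sigmaField (Set.mem_univ _) i).mul (measurable_sigmaField (Set.mem_univ _) i))
    ((hN.memLp _ (hb s hs) j).integrable_mul (hN.memLp _ (hb t ht) j)) hint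
    (hN.uncorr _ (hb s hs) _ (hb t ht) (hinj.ne hst.ne) j j)

theorem CondNoise.hasSecondMomentLE_noise_mul (hN : CondNoise P f ε n σε)
    (hf : ∀ t, Measurable (f t)) {s t : ℤ} (hs : s ∈ Set.Icc (1 : ℤ) n)
    (ht : t ∈ Set.Icc (1 : ℤ) n) (hst : s ≠ t) (i j : Fin p) :
    HasSecondMomentLE P (fun ω => ε s ω i * ε t ω j) (σε ^ 2 * σε ^ 2) := by
  have hs₂ := hN.hasSecondMomentLE hf hs i
  have ht₂ := hN.hasSecondMomentLE hf ht j
  have hind : IndepFun (fun ω => ε s ω i ^ 2) (fun ω => ε t ω j ^ 2) P :=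
    (hN.indep.indepFun hst).comp (φ := fun v : Fin p → ℝ => v i ^ 2)
      (ψ := fun v : Fin p → ℝ => v j ^ 2) (by fun_prop) (by fun_prop)
  have hint : Integrable (fun ω => (ε s ω i * ε t ω j) ^ 2) P := by
    simp only [mul_pow]
    exact hind.integrable_mul hs₂.memLp.integrable_sq ht₂.memLp.integrable_sq
  refine ⟨(memLp_two_iff_integrable_sq
    (hs₂.memLp.aestronglyMeasurable.mul ht₂.memLp.aestronglyMeasurable)).2 hint, ?_⟩
  simp only [mul_pow]
  rw [hind.integral_fun_mul_eq_mul_integral hs₂.memLp.integrable_sq.aestronglyMeasurable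
    ht₂.memLp.integrable_sq.aestronglyMeasurable]
  exact mul_le_mul hs₂.integral_sq_le ht₂.integral_sq_le (integral_nonneg fun ω => sq_nonneg _)
    (sq_nonneg _)

theorem CondNoise.integral_noise_mul_mul_eq_zero (hN : CondNoise P f ε n σε)
    (hf : ∀ t, Measurable (f t)) (hε : ∀ t, Measurable (ε t)) {s t u v : ℤ}
    (hs : s ∈ Set.Icc (1 : ℤ) n) (hst : s ≠ t) (hsu : s ≠ u) (hsv : s ≠ v) (i j : Fin p) :
    ∫ ω, (ε s ω i * ε t ω j) * (ε u ω i * ε v ω j) ∂P = 0 := by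
  have hmeas (t : ℤ) (i : Fin p) : Measurable fun ω => ε t ω i :=
    (measurable_pi_apply i).comp (hε t)
  have hdisj : Disjoint ({s} : Finset ℤ) {t, u, v} := by simp [hst, hsu, hsv]
  have hind : IndepFun (fun ω => ε s ω i) (fun ω => ε t ω j * (ε u ω i * ε v ω j)) P :=
    (hN.indep.indepFun_finset {s} {t, u, v} hdisj hε).comp
      (φ := fun w : (({s} : Finset ℤ) → Fin p → ℝ) => w ⟨s, by simp⟩ i)
      (ψ := fun w : (({t, u, v} : Finset ℤ) → Fin p → ℝ) =>
        w ⟨t, by simp⟩ j * (w ⟨u, by simp⟩ i * w ⟨v, by simp⟩ j))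
      (by fun_prop) (by fun_prop)
  simp only [mul_assoc]
  rw [hind.integral_fun_mul_eq_mul_integral (hmeas s i).aestronglyMeasurable
      ((hmeas t j).mul ((hmeas u i).mul (hmeas v j))).aestronglyMeasurable,
    integral_eq_zero_of_condExp_eq_zero (sigmaField_le hf Set.univ) (hN.centred s hs i), zero_mul]

theorem hasSecondMomentLE_noise_average (hN : CondNoise P f ε n σε) (hf : ∀ t, Measurable (f t))
    (hε : ∀ t, Measurable (ε t)) (hh : 1 ≤ h) (i j : Fin p) :
    HasSecondMomentLE P
      (fun ω => ((Finset.Icc 1 (n - h)).card : ℝ)⁻¹ * ∑ t ∈ Finset.Icc 1 (n - h),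
        ε t ω i * ε (t + h) ω j)
      (2 * (σε ^ 2 * σε ^ 2) / (Finset.Icc 1 (n - h)).card) :=
  hasSecondMomentLE_average_of_orthogonal (by positivity)
    (fun _ ht => hN.hasSecondMomentLE_noise_mul hf (mem_Icc_of_mem_window ht).1
      (mem_Icc_of_mem_window ht).2 (by omega) i j)
    fun _ hs _ _ _ => hN.integral_noise_mul_mul_eq_zero hf hε (mem_Icc_of_mem_window hs).1
      (by omega) (by omega) (by omega) i j

end Noise

section Frobenius

open Matrix
open scoped Matrix.Norms.Frobenius

/-! ### Trace maximizers under perturbation -/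

section TraceMaximizer

variable {m n : Type*} [Fintype m] [Fintype n]

theorem frobenius_norm_sq (A : Matrix m n ℝ) : ‖A‖ ^ 2 = ∑ i, ∑ j, A i j ^ 2 := by
  rw [frobenius_norm_def, ← Real.sqrt_eq_rpow, Real.sq_sqrt (by positivity)]
  simp only [Real.norm_eq_abs, Real.rpow_two, sq_abs]

theorem trace_mul_transpose_self (A : Matrix m n ℝ) : (A * Aᵀ).trace = ‖A‖ ^ 2 := by
  rw [frobenius_norm_sq]
  simp only [trace, diag_apply, mul_apply, transpose_apply, sq]

theorem trace_mul_transpose_le (A B : Matrix m n ℝ) : (A * Bᵀ).trace ≤ ‖A‖ * ‖B‖ := by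
  have h := Real.sum_mul_le_sqrt_mul_sqrt Finset.univ
    (fun x : m × n => A x.1 x.2) (fun x => B x.1 x.2)
  simp only [Fintype.sum_prod_type, ← frobenius_norm_sq, Real.sqrt_sq (norm_nonneg _)] at h
  simpa only [trace, diag_apply, mul_apply, transpose_apply] using h

theorem norm_toLp_mulVec_le (A : Matrix m n ℝ) (v : n → ℝ) :
    ‖WithLp.toLp 2 (A *ᵥ v)‖ ≤ ‖A‖ * ‖WithLp.toLp 2 v‖ := by
  refine le_of_sq_le_sq ?_ (by positivity)
  simp only [mul_pow, frobenius_norm_sq, EuclideanSpace.norm_sq_eq, Real.norm_eq_abs, sq_abs]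
  rw [Finset.sum_mul]
  exact Finset.sum_le_sum fun i _ => Finset.sum_mul_sq_le_sq_mul_sq Finset.univ (A i) v

theorem trace_mul_mul_transpose (X : Matrix m m ℝ) (U : Matrix m n ℝ) :
    (X * (U * Uᵀ)).trace = (Uᵀ * X * U).trace := by
  rw [← Matrix.mul_assoc, trace_mul_comm, ← Matrix.mul_assoc]

variable [DecidableEq n] {S T : Matrix m n ℝ}

theorem norm_mul_transpose_sub_sq (hS : Sᵀ * S = 1) (hT : Tᵀ * T = 1) :
    ‖T * Tᵀ - S * Sᵀ‖ ^ 2 = 2 * (Fintype.card n - (T * Tᵀ * (S * Sᵀ)).trace) := by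
  have expand : (T * Tᵀ - S * Sᵀ) * (T * Tᵀ - S * Sᵀ)ᵀ
      = T * (Tᵀ * T) * Tᵀ + S * (Sᵀ * S) * Sᵀ - T * Tᵀ * (S * Sᵀ) - S * Sᵀ * (T * Tᵀ) := by
    simp only [transpose_sub, transpose_mul, transpose_transpose, Matrix.mul_sub, Matrix.sub_mul,
      Matrix.mul_assoc]
    abel
  rw [← trace_mul_transpose_self, expand, hS, hT, trace_sub, trace_sub, trace_add, Matrix.mul_one,
    Matrix.mul_one, trace_mul_comm T, trace_mul_comm S Sᵀ, hS, hT, trace_mul_comm (S * Sᵀ),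
    trace_one]
  ring

theorem trace_le_card (hS : Sᵀ * S = 1) (hT : Tᵀ * T = 1) :
    (T * Tᵀ * (S * Sᵀ)).trace ≤ Fintype.card n := by
  have h := norm_mul_transpose_sub_sq hS hT
  linarith [sq_nonneg ‖T * Tᵀ - S * Sᵀ‖]

theorem norm_mul_transpose_sub_le (hS : Sᵀ * S = 1) (hT : Tᵀ * T = 1) :
    ‖T * Tᵀ - S * Sᵀ‖ ≤ 2 * Fintype.card n := by
  have trace_eq : (T * Tᵀ * (S * Sᵀ)).trace = ‖Sᵀ * T‖ ^ 2 := by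
    rw [trace_mul_mul_transpose, ← trace_mul_transpose_self, transpose_mul, transpose_transpose]
    simp only [Matrix.mul_assoc]
  have h := norm_mul_transpose_sub_sq hS hT
  rw [trace_eq] at h
  refine abs_le_of_sq_le_sq' ?_ (by positivity) |>.2
  have card_le_sq : (Fintype.card n : ℝ) ≤ (Fintype.card n : ℝ) ^ 2 := by
    exact_mod_cast Nat.le_self_pow two_ne_zero _
  nlinarith [sq_nonneg ‖Sᵀ * T‖]

/-- The part of `S` orthogonal to the column space of `T`, when `TᵀT = 1`. -/
def residual (S T : Matrix m n ℝ) : Matrix m n ℝ := S - T * (Tᵀ * S)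

theorem residual_transpose_mul_residual (hS : Sᵀ * S = 1) (hT : Tᵀ * T = 1) :
    (residual S T)ᵀ * residual S T = 1 - Sᵀ * T * (Tᵀ * S) := by
  have expand : (residual S T)ᵀ * residual S T
      = Sᵀ * S - Sᵀ * T * (Tᵀ * S) - Sᵀ * T * (Tᵀ * S) + Sᵀ * T * (Tᵀ * T) * (Tᵀ * S) := by
    simp only [residual, transpose_sub, transpose_mul, transpose_transpose, Matrix.mul_sub,
      Matrix.sub_mul, Matrix.mul_assoc]
    abel
  rw [expand, hS, hT, Matrix.mul_one]
  abel

theorem trace_residual_mul_mul_transpose (hS : Sᵀ * S = 1) (hT : Tᵀ * T = 1) (N : Matrix n n ℝ) :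
    (residual S T * N * (residual S T)ᵀ).trace
      = N.trace - (Tᵀ * (S * N * Sᵀ) * T).trace := by
  have cyclic : (N * (Sᵀ * T * (Tᵀ * S))).trace = (Tᵀ * (S * N * Sᵀ) * T).trace := by
    rw [← Matrix.mul_assoc, trace_mul_comm]
    simp only [Matrix.mul_assoc]
  rw [Matrix.mul_assoc, trace_mul_comm, Matrix.mul_assoc, residual_transpose_mul_residual hS hT,
    Matrix.mul_sub, Matrix.mul_one, trace_sub, cyclic]

theorem mul_card_sub_trace_le {N : Matrix n n ℝ} {l : ℝ} (hS : Sᵀ * S = 1) (hT : Tᵀ * T = 1)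
    (hN : (N - l • (1 : Matrix n n ℝ)).PosSemidef) :
    l * (Fintype.card n - (T * Tᵀ * (S * Sᵀ)).trace)
      ≤ N.trace - (Tᵀ * (S * N * Sᵀ) * T).trace := by
  have h := (hN.mul_mul_conjTranspose_same (residual S T)).trace_nonneg
  rw [conjTranspose_eq_transpose_of_trivial, trace_residual_mul_mul_transpose hS hT] at h
  simp only [Matrix.mul_sub, Matrix.sub_mul, Matrix.mul_smul, Matrix.smul_mul, Matrix.mul_one,
    trace_sub, trace_smul, trace_one, smul_eq_mul] at h
  rw [trace_mul_comm (T * Tᵀ), trace_mul_mul_transpose]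
  linarith

theorem norm_mul_transpose_sub_le_of_trace_le {M : Matrix m m ℝ} {N : Matrix n n ℝ} {l : ℝ}
    (hl : 0 < l) (hS : Sᵀ * S = 1) (hT : Tᵀ * T = 1)
    (hN : (N - l • (1 : Matrix n n ℝ)).PosSemidef)
    (hmax : (Sᵀ * M * S).trace ≤ (Tᵀ * M * T).trace) :
    ‖T * Tᵀ - S * Sᵀ‖ ≤ 2 * ‖M - S * N * Sᵀ‖ / l := by
  have trace_S : (Sᵀ * (S * N * Sᵀ) * S).trace = N.trace := by
    rw [show Sᵀ * (S * N * Sᵀ) * S = (Sᵀ * S) * N * (Sᵀ * S) by simp only [Matrix.mul_assoc], hS,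
      Matrix.one_mul, Matrix.mul_one]
  have trace_diff : ((M - S * N * Sᵀ) * (T * Tᵀ - S * Sᵀ)ᵀ).trace
      = (Tᵀ * M * T).trace - (Tᵀ * (S * N * Sᵀ) * T).trace
        - (Sᵀ * M * S).trace + N.trace := by
    simp only [transpose_sub, transpose_mul, transpose_transpose, Matrix.mul_sub (_ - _),
      Matrix.sub_mul M, trace_sub, trace_mul_mul_transpose, trace_S]
    ring
  have gap := mul_card_sub_trace_le hS hT hN
  have cauchy_schwarz := trace_mul_transpose_le (M - S * N * Sᵀ) (T * Tᵀ - S * Sᵀ)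
  have key : l * ‖T * Tᵀ - S * Sᵀ‖ ^ 2 ≤ 2 * ‖M - S * N * Sᵀ‖ * ‖T * Tᵀ - S * Sᵀ‖ := by
    rw [norm_mul_transpose_sub_sq hS hT]
    linarith
  rw [le_div_iff₀ hl]
  rcases (norm_nonneg (T * Tᵀ - S * Sᵀ)).eq_or_lt with h0 | h0
  · rw [← h0, zero_mul]
    positivity
  · nlinarith

end TraceMaximizer

/-! ### Orthogonal projections onto column spaces -/

section Projection

variable {p r : ℕ} {S T : Matrix (Fin p) (Fin r) ℝ}

theorem mem_colSpace_iff {Z : Matrix (Fin p) (Fin r) ℝ} {v : EuclideanSpace ℝ (Fin p)} :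
    v ∈ colSpace Z ↔ ∃ w : Fin r → ℝ, WithLp.toLp 2 (Z *ᵥ w) = v := by
  have toLp_mulVec (w : Fin r → ℝ) :
      (WithLp.toLp 2 (Z *ᵥ w) : EuclideanSpace ℝ (Fin p)) = ∑ j, w j • col Z j := by
    ext i
    simp only [mulVec, dotProduct, col, WithLp.ofLp_sum, WithLp.ofLp_smul, Finset.sum_apply,
      Pi.smul_apply, smul_eq_mul, mul_comm]
  simp only [colSpace, Submodule.mem_span_range_iff_exists_fun, toLp_mulVec]

theorem starProjection_colSpace_apply (hS : Sᵀ * S = 1) (v : EuclideanSpace ℝ (Fin p)) :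
    (colSpace S).starProjection v = WithLp.toLp 2 ((S * Sᵀ) *ᵥ v.ofLp) := by
  refine Submodule.eq_starProjection_of_mem_of_inner_eq_zero ?_ fun w hw => ?_
  · exact mem_colSpace_iff.2 ⟨Sᵀ *ᵥ v.ofLp, by rw [mulVec_mulVec]⟩
  · obtain ⟨u, rfl⟩ := mem_colSpace_iff.1 hw
    rw [EuclideanSpace.inner_eq_star_dotProduct, star_trivial, WithLp.ofLp_sub, dotProduct_comm,
      dotProduct_mulVec, ← mulVec_transpose, mulVec_sub, mulVec_mulVec, ← Matrix.mul_assoc, hS,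
      Matrix.one_mul, sub_self, zero_dotProduct]

theorem projDist_colSpace_le (hS : Sᵀ * S = 1) (hT : Tᵀ * T = 1) :
    projDist (colSpace T) (colSpace S) ≤ ‖T * Tᵀ - S * Sᵀ‖ := by
  refine ContinuousLinearMap.opNorm_le_bound _ (norm_nonneg _) fun v => ?_
  rw [_root_.sub_apply, starProjection_colSpace_apply hS,
    starProjection_colSpace_apply hT, ← WithLp.toLp_sub, ← Matrix.sub_mulVec]
  exact norm_toLp_mulVec_le _ _

theorem trace_starProjection_comp (hS : Sᵀ * S = 1) (hT : Tᵀ * T = 1) :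
    LinearMap.trace ℝ (EuclideanSpace ℝ (Fin p))
      (((colSpace T).starProjection ∘L (colSpace S).starProjection).toLinearMap)
      = (T * Tᵀ * (S * Sᵀ)).trace := by
  have comp_eq : ((colSpace T).starProjection ∘L (colSpace S).starProjection).toLinearMap
      = Matrix.toLpLin 2 2 (T * Tᵀ * (S * Sᵀ)) := by
    ext v : 1
    rw [ContinuousLinearMap.coe_coe, ContinuousLinearMap.comp_apply,
      starProjection_colSpace_apply hS, starProjection_colSpace_apply hT, toLpLin_apply,
      mulVec_mulVec]
  rw [comp_eq, toLpLin_eq_toLin, trace_toLin_eq]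

theorem traceDist_colSpace_le (hr : 1 ≤ r) (hS : Sᵀ * S = 1) (hT : Tᵀ * T = 1) :
    traceDist r (colSpace T) (colSpace S) ≤ ‖T * Tᵀ - S * Sᵀ‖ := by
  have hr' : (1 : ℝ) ≤ r := by exact_mod_cast hr
  have norm_sq := norm_mul_transpose_sub_sq hS hT
  have trace_le := trace_le_card hS hT
  rw [Fintype.card_fin] at norm_sq trace_le
  rw [traceDist, trace_starProjection_comp hS hT, Real.sqrt_le_iff]
  refine ⟨norm_nonneg _, ?_⟩
  calc 1 - (T * Tᵀ * (S * Sᵀ)).trace / r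
      = (r - (T * Tᵀ * (S * Sᵀ)).trace) / r := by field_simp
    _ ≤ r - (T * Tᵀ * (S * Sᵀ)).trace := div_le_self (sub_nonneg.2 trace_le) hr'
    _ ≤ ‖T * Tᵀ - S * Sᵀ‖ ^ 2 := by linarith

end Projection

end Frobenius

/-! ### Loading matrices of full column rank -/

section Loading

open Matrix

variable {p r : ℕ} {As : Matrix (Fin p) (Fin r) ℝ}

theorem linearIndependent_col_iff : LinearIndependent ℝ (col As) ↔ LinearIndependent ℝ As.col :=
  LinearMap.linearIndependent_iff (WithLp.linearEquiv 2 ℝ (Fin p → ℝ)).symm.toLinearMap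
    (LinearEquiv.ker _)

theorem ncard_nonzero_eigenvalues_le_finrank_range {V : Type*} [AddCommGroup V] [Module ℝ V]
    [FiniteDimensional ℝ V] (T : Module.End ℝ V) :
    {μ : ℝ | μ ≠ 0 ∧ T.HasEigenvalue μ}.ncard ≤ Module.finrank ℝ (LinearMap.range T) := by
  set E := {μ : ℝ | μ ≠ 0 ∧ T.HasEigenvalue μ}
  have finite_E : E.Finite := T.finite_hasEigenvalue.subset fun μ hμ => hμ.2
  have := finite_E.fintype
  choose v hv using fun μ : E => μ.2.2.exists_hasEigenvector
  have mem_range (μ : E) : v μ ∈ LinearMap.range T :=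
    ⟨(μ : ℝ)⁻¹ • v μ, by rw [map_smul, (hv μ).apply_eq_smul, smul_smul, inv_mul_cancel₀ μ.2.1,
      one_smul]⟩
  have independent : LinearIndependent ℝ fun μ : E => (⟨v μ, mem_range μ⟩ : LinearMap.range T) :=
    .of_comp (LinearMap.range T).subtype
      (T.eigenvectors_linearIndependent' (fun μ : E => (μ : ℝ)) Subtype.val_injective v hv)
  rw [← Nat.card_coe_set_eq, Nat.card_eq_fintype_card]
  exact independent.fintype_card_le_finrank

theorem linearIndependent_col_of_condEigen {B : Matrix (Fin r) (Fin p) ℝ}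
    (h : CondEigen r (As * B)) : LinearIndependent ℝ (col As) := by
  have le_rank : r ≤ As.rank := calc
    r = {μ : ℝ | μ ≠ 0 ∧ Module.End.HasEigenvalue (toLin' (As * B)) μ}.ncard := h.symm
    _ ≤ (As * B).rank := ncard_nonzero_eigenvalues_le_finrank_range _
    _ ≤ As.rank := rank_mul_le_left As B
  rw [linearIndependent_col_iff, linearIndependent_iff_card_le_finrank_span, Fintype.card_fin]
  rwa [rank_eq_finrank_span_cols] at le_rank

theorem span_range_smul {ι V : Type*} [AddCommGroup V] [Module ℝ V] {c : ι → ℝ}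
    (hc : ∀ i, c i ≠ 0) (v : ι → V) :
    Submodule.span ℝ (Set.range fun i => c i • v i) = Submodule.span ℝ (Set.range v) := by
  refine le_antisymm (Submodule.span_le.2 ?_) (Submodule.span_le.2 ?_)
  · rintro _ ⟨i, rfl⟩
    exact Submodule.smul_mem _ _ (Submodule.subset_span ⟨i, rfl⟩)
  · rintro _ ⟨i, rfl⟩
    exact (Submodule.smul_mem_iff _ (hc i)).1 (Submodule.subset_span ⟨i, rfl⟩)

theorem colSpace_orthLoading (hli : LinearIndependent ℝ (col As)) :
    colSpace (orthLoading As) = colSpace As := by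
  calc colSpace (orthLoading As)
      = Submodule.span ℝ (Set.range (InnerProductSpace.gramSchmidt ℝ (col (stdLoading As)))) := rfl
    _ = Submodule.span ℝ (Set.range (col (stdLoading As))) := InnerProductSpace.span_gramSchmidt ..
    _ = colSpace As := span_range_smul (fun j => inv_ne_zero
        (norm_ne_zero_iff.2 (InnerProductSpace.gramSchmidt_ne_zero j hli))) (col As)

theorem exists_orthonormal_factor (hli : LinearIndependent ℝ (col As)) :
    ∃ (S : Matrix (Fin p) (Fin r) ℝ) (R : Matrix (Fin r) (Fin r) ℝ),
      Sᵀ * S = 1 ∧ colSpace S = colSpace As ∧ S * R = As := by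
  let S : Matrix (Fin p) (Fin r) ℝ :=
    Matrix.of fun i j => InnerProductSpace.gramSchmidtNormed ℝ (col As) j i
  have col_S : col S = InnerProductSpace.gramSchmidtNormed ℝ (col As) := rfl
  have colSpace_S : colSpace S = colSpace As := by
    rw [colSpace, col_S, InnerProductSpace.span_gramSchmidtNormed_range,
      InnerProductSpace.span_gramSchmidt, colSpace]
  have col_mem (j : Fin r) : col As j ∈ colSpace S :=
    colSpace_S ▸ Submodule.subset_span ⟨j, rfl⟩
  choose R hR using fun j => mem_colSpace_iff.1 (col_mem j)
  refine ⟨S, (Matrix.of R)ᵀ, ?_, colSpace_S, ?_⟩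
  · ext i j
    have h := orthonormal_iff_ite.1 (InnerProductSpace.gramSchmidtNormed_orthonormal hli) i j
    rw [← col_S, EuclideanSpace.inner_eq_star_dotProduct, star_trivial, dotProduct_comm] at h
    exact h
  · ext i j
    exact congrFun (congrArg WithLp.ofLp (hR j)) i

end Loading

/-! ### Lower bounds on eigenvalues -/

section Eigenvalues

open Matrix

variable {n : Type*} [Fintype n] [DecidableEq n]

open scoped MatrixOrder Matrix.Norms.L2Operator in
theorem posSemidef_sub_smul_one_iff {B : Matrix n n ℝ} (hB : B.IsHermitian) {l : ℝ} :
    (B - l • (1 : Matrix n n ℝ)).PosSemidef ↔ ∀ x ∈ spectrum ℝ B, l ≤ x := by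
  rw [← algebraMap_le_iff_le_spectrum (a := B) hB, le_iff, Algebra.algebraMap_eq_smul_one]

theorem posSemidef_mul_transpose_sub_smul_one {R : Matrix n n ℝ} {l : ℝ}
    (h : (Rᵀ * R - l • (1 : Matrix n n ℝ)).PosSemidef) :
    (R * Rᵀ - l • (1 : Matrix n n ℝ)).PosSemidef := by
  have spectrum_eq : spectrum ℝ (R * Rᵀ) = spectrum ℝ (Rᵀ * R) := by
    ext x
    rw [mem_spectrum_iff_isRoot_charpoly, mem_spectrum_iff_isRoot_charpoly, charpoly_mul_comm]
  have hermitian (Q : Matrix n n ℝ) : (Q * Qᵀ).IsHermitian := by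
    rw [← conjTranspose_eq_transpose_of_trivial]
    exact isHermitian_mul_conjTranspose_self Q
  rw [posSemidef_sub_smul_one_iff (hermitian R), spectrum_eq]
  exact (posSemidef_sub_smul_one_iff (hermitian Rᵀ)).1 h

theorem minSing_nonneg {p r : ℕ} (Z : Matrix (Fin p) (Fin r) ℝ) : 0 ≤ minSing Z :=
  Real.sInf_nonneg fun _ hs => hs.1.le

open scoped MatrixOrder Matrix.Norms.L2Operator in
theorem posSemidef_transpose_mul_sub_minSing {p r : ℕ} {As : Matrix (Fin p) (Fin r) ℝ}
    (hli : LinearIndependent ℝ (col As)) :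
    (Asᵀ * As - minSing As ^ 2 • (1 : Matrix (Fin r) (Fin r) ℝ)).PosSemidef := by
  have posDef : (Asᵀ * As).PosDef := by
    rw [← conjTranspose_eq_transpose_of_trivial]
    exact .conjTranspose_mul_self As (mulVec_injective_iff.2 (linearIndependent_col_iff.1 hli))
  refine (posSemidef_sub_smul_one_iff posDef.isHermitian).2 fun x hx => ?_
  have hx_pos : 0 < x := posDef.isStrictlyPositive.spectrum_pos hx
  have minSing_le : minSing As ≤ √x := by
    refine csInf_le ⟨0, fun s hs => hs.1.le⟩ ⟨Real.sqrt_pos.2 hx_pos, ?_⟩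
    rwa [Real.sq_sqrt hx_pos.le, Module.End.hasEigenvalue_iff_mem_spectrum, spectrum_toLin']
  exact (Real.le_sqrt (minSing_nonneg As) hx_pos.le).1 minSing_le

theorem posSemidef_sum_mul_mul_transpose_sub {ι : Type*} (I : Finset ι) (F : ι → Matrix n n ℝ)
    {G R : Matrix n n ℝ} {c l : ℝ} (hc : 0 ≤ c) (hl : 0 ≤ l)
    (hF : (∑ h ∈ I, F h * (F h)ᵀ - c • (1 : Matrix n n ℝ)).PosSemidef)
    (hG : (G - l • (1 : Matrix n n ℝ)).PosSemidef)
    (hR : (R * Rᵀ - l • (1 : Matrix n n ℝ)).PosSemidef) :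
    (R * (∑ h ∈ I, F h * G * (F h)ᵀ) * Rᵀ - (c * l ^ 2) • (1 : Matrix n n ℝ)).PosSemidef := by
  have inner_gap : (∑ h ∈ I, F h * (G - l • (1 : Matrix n n ℝ)) * (F h)ᵀ).PosSemidef :=
    posSemidef_sum I fun h _ => hG.mul_mul_conjTranspose_same (F h)
  have split : R * (∑ h ∈ I, F h * G * (F h)ᵀ) * Rᵀ - (c * l ^ 2) • (1 : Matrix n n ℝ)
      = R * (∑ h ∈ I, F h * (G - l • (1 : Matrix n n ℝ)) * (F h)ᵀ) * Rᵀ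
        + l • (R * (∑ h ∈ I, F h * (F h)ᵀ - c • (1 : Matrix n n ℝ)) * Rᵀ)
        + (l * c) • (R * Rᵀ - l • (1 : Matrix n n ℝ)) := by
    simp only [Matrix.mul_sub, Matrix.sub_mul, Matrix.mul_smul, Matrix.smul_mul, Matrix.mul_one,
      Finset.sum_sub_distrib, ← Finset.smul_sum, smul_sub, smul_smul]
    rw [show c * l ^ 2 = l * c * l by ring]
    abel
  rw [split]
  exact ((inner_gap.mul_mul_conjTranspose_same R).add
    ((hF.mul_mul_conjTranspose_same R).smul hl)).add (hR.smul (mul_nonneg hl hc))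

end Eigenvalues

/-! ### Decomposition of the autocovariances -/

section Expectation

variable {Ω l m n : Type*} [MeasurableSpace Ω] {P : Measure Ω}

/-- The random matrix `Z` is integrable with expectation `M`, entry by entry. -/
def HasMean (P : Measure Ω) (Z : Ω → Matrix m n ℝ) (M : Matrix m n ℝ) : Prop :=
  ∀ i j, Integrable (fun ω => Z ω i j) P ∧ ∫ ω, Z ω i j ∂P = M i j

theorem HasMean.unique {Z : Ω → Matrix m n ℝ} {M N : Matrix m n ℝ} (hM : HasMean P Z M)
    (hN : HasMean P Z N) : M = N := by
  ext i j
  rw [← (hM i j).2, (hN i j).2]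

theorem HasMean.add {Z W : Ω → Matrix m n ℝ} {M N : Matrix m n ℝ} (hZ : HasMean P Z M)
    (hW : HasMean P W N) : HasMean P (fun ω => Z ω + W ω) (M + N) := fun i j =>
  ⟨(hZ i j).1.add (hW i j).1, by
    simp only [Matrix.add_apply, integral_add (hZ i j).1 (hW i j).1, (hZ i j).2, (hW i j).2]⟩

theorem HasMean.transpose {Z : Ω → Matrix m n ℝ} {M : Matrix m n ℝ} (hZ : HasMean P Z M) :
    HasMean P (fun ω => (Z ω).transpose) M.transpose := fun i j => hZ j i

theorem HasMean.const_mul [Fintype m] {Z : Ω → Matrix m n ℝ} {M : Matrix m n ℝ}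
    (A : Matrix l m ℝ) (hZ : HasMean P Z M) : HasMean P (fun ω => A * Z ω) (A * M) := fun i j => by
  have hint : ∀ a ∈ Finset.univ, Integrable (fun ω => A i a * Z ω a j) P := fun a _ =>
    (hZ a j).1.const_mul _
  simp only [Matrix.mul_apply]
  refine ⟨integrable_finsetSum _ hint, ?_⟩
  simp only [integral_finsetSum _ hint, integral_const_mul, (hZ _ _).2]

theorem HasMean.mul_const [Fintype n] {Z : Ω → Matrix m n ℝ} {M : Matrix m n ℝ}
    (A : Matrix n l ℝ) (hZ : HasMean P Z M) : HasMean P (fun ω => Z ω * A) (M * A) := by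
  simpa only [Matrix.transpose_mul, Matrix.transpose_transpose] using
    (hZ.transpose.const_mul A.transpose).transpose

end Expectation

section Crosscovariance

variable {Ω : Type*} {d e : ℕ} {y : ℤ → Ω → Fin d → ℝ} {z : ℤ → Ω → Fin e → ℝ} {n : ℕ}

/-- `(n-h)⁻¹ ∑_{t=1}^{n-h} y_t z_{t+h}ᵀ`; for `z = y` this is `sampleAutocov`. -/
noncomputable def sampleCrosscov (y : ℤ → Ω → Fin d → ℝ) (z : ℤ → Ω → Fin e → ℝ) (n h : ℕ)
    (ω : Ω) : Matrix (Fin d) (Fin e) ℝ :=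
  Matrix.of fun i j =>
    ((n : ℝ) - (h : ℝ))⁻¹ * ∑ t ∈ Finset.Icc 1 (n - h), y (t : ℤ) ω i * z ((t : ℤ) + h) ω j

theorem sampleCrosscov_eq_smul_sum (y : ℤ → Ω → Fin d → ℝ) (z : ℤ → Ω → Fin e → ℝ) (n h : ℕ)
    (ω : Ω) : sampleCrosscov y z n h ω = ((n : ℝ) - (h : ℝ))⁻¹ •
      ∑ t ∈ Finset.Icc 1 (n - h), Matrix.vecMulVec (y (t : ℤ) ω) (z ((t : ℤ) + h) ω) := by
  ext i j
  simp only [sampleCrosscov, Matrix.of_apply, Matrix.smul_apply, Matrix.sum_apply,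
    Matrix.vecMulVec_apply, smul_eq_mul]

variable [MeasurableSpace Ω] {P : Measure Ω}

/-- `(n-h)⁻¹ ∑_{t=1}^{n-h} E(y_t z_{t+h}ᵀ)`; for `z = y` this is `autocov`. -/
noncomputable def crosscov (P : Measure Ω) (y : ℤ → Ω → Fin d → ℝ) (z : ℤ → Ω → Fin e → ℝ)
    (n h : ℕ) : Matrix (Fin d) (Fin e) ℝ :=
  Matrix.of fun i j =>
    ((n : ℝ) - (h : ℝ))⁻¹ * ∑ t ∈ Finset.Icc 1 (n - h), ∫ ω, y (t : ℤ) ω i * z ((t : ℤ) + h) ω j ∂P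

theorem hasMean_sampleCrosscov (hy : ∀ t ∈ Set.Icc (1 : ℤ) n, ∀ i, MemLp (fun ω => y t ω i) 2 P)
    (hz : ∀ t ∈ Set.Icc (1 : ℤ) n, ∀ i, MemLp (fun ω => z t ω i) 2 P) (h : ℕ) :
    HasMean P (sampleCrosscov y z n h) (crosscov P y z n h) := fun i j => by
  have hint : ∀ t ∈ Finset.Icc 1 (n - h),
      Integrable (fun ω => y (t : ℤ) ω i * z ((t : ℤ) + h) ω j) P := fun t ht =>
    (hy _ (mem_Icc_of_mem_window ht).1 i).integrable_mul (hz _ (mem_Icc_of_mem_window ht).2 j)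
  simp only [sampleCrosscov, crosscov, Matrix.of_apply]
  exact ⟨(integrable_finsetSum _ hint).const_mul _, by
    rw [integral_const_mul, integral_finsetSum _ hint]⟩

theorem crosscov_eq_zero {h : ℕ} (hyz : ∀ t ∈ Finset.Icc 1 (n - h), ∀ i j,
    ∫ ω, y (t : ℤ) ω i * z ((t : ℤ) + h) ω j ∂P = 0) : crosscov P y z n h = 0 := by
  ext i j
  simp only [crosscov, Matrix.of_apply, Finset.sum_eq_zero fun t ht => hyz t ht i j, mul_zero,
    Matrix.zero_apply]

end Crosscovariance

section Decomposition

open Matrix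

variable {Ω : Type*} {p r n h : ℕ} {As : Matrix (Fin p) (Fin r) ℝ} {f : ℤ → Ω → Fin r → ℝ}
  {x ε : ℤ → Ω → Fin p → ℝ} {γ σf σε : ℝ}

theorem vecMulVec_mulVec_add {l m : Type*} [Fintype m] (A : Matrix l m ℝ) (u v : m → ℝ)
    (a b : l → ℝ) :
    vecMulVec (A *ᵥ u + a) (A *ᵥ v + b) =
      A * vecMulVec u v * Aᵀ + A * vecMulVec u b + vecMulVec a v * Aᵀ + vecMulVec a b := by
  rw [add_vecMulVec, vecMulVec_add, vecMulVec_add, mul_vecMulVec, vecMulVec_mul, vecMulVec_mul,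
    mul_vecMulVec, vecMul_transpose]
  abel

theorem sampleAutocov_eq_add (hx : ∀ t ω, x t ω = As *ᵥ f t ω + ε t ω) (n h : ℕ) (ω : Ω) :
    sampleAutocov x n h ω = As * sampleAutocov f n h ω * Asᵀ + As * sampleCrosscov f ε n h ω
      + sampleCrosscov ε f n h ω * Asᵀ + sampleCrosscov ε ε n h ω := by
  change sampleCrosscov x x n h ω = As * sampleCrosscov f f n h ω * Asᵀ + _ + _ + _
  simp only [sampleCrosscov_eq_smul_sum, hx, vecMulVec_mulVec_add, Finset.sum_add_distrib,
    smul_add, Matrix.mul_smul, Matrix.smul_mul, Matrix.mul_sum, Matrix.sum_mul]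

variable [MeasurableSpace Ω] {P : Measure Ω}

theorem memLp_mulVec_add {a : Ω → Fin r → ℝ} {b : Ω → Fin p → ℝ}
    (ha : ∀ j, MemLp (fun ω => a ω j) 2 P) (hb : ∀ i, MemLp (fun ω => b ω i) 2 P)
    (A : Matrix (Fin p) (Fin r) ℝ) (i : Fin p) : MemLp (fun ω => (A *ᵥ a ω + b ω) i) 2 P :=
  (memLp_finsetSum Finset.univ fun j _ => (ha j).const_mul (A i j)).add (hb i)

theorem autocov_eq_mul_mul_transpose [IsProbabilityMeasure P] (hγ : 1 ≤ γ) (hσf : 0 ≤ σf)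
    (hf : ∀ t, Measurable (f t)) (hmom : CondMoment P f n γ σf) (hN : CondNoise P f ε n σε)
    (hx : ∀ t ω, x t ω = As *ᵥ f t ω + ε t ω) (hh : 1 ≤ h) :
    autocov P x n h = As * autocov P f n h * Asᵀ := by
  have hfLp : ∀ t ∈ Set.Icc (1 : ℤ) n, ∀ j, MemLp (fun ω => f t ω j) 2 P := fun t ht j =>
    (hmom.hasSecondMomentLE hγ hσf hf ht j).memLp
  have hxLp : ∀ t ∈ Set.Icc (1 : ℤ) n, ∀ i, MemLp (fun ω => x t ω i) 2 P := fun t ht i => by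
    simpa only [hx] using memLp_mulVec_add (hfLp t ht) (hN.memLp t ht) As i
  have hfε : crosscov P f ε n h = 0 := crosscov_eq_zero fun t ht =>
    hN.integral_factor_mul_eq_zero hf hγ hσf hmom (mem_Icc_of_mem_window ht).1
      (mem_Icc_of_mem_window ht).2
  have hεf : crosscov P ε f n h = 0 := crosscov_eq_zero fun t ht i j => by
    simpa only [mul_comm] using hN.integral_factor_mul_eq_zero hf hγ hσf hmom
      (mem_Icc_of_mem_window ht).2 (mem_Icc_of_mem_window ht).1 j i
  have hεε : crosscov P ε ε n h = 0 := crosscov_eq_zero fun t ht =>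
    hN.integral_noise_mul_eq_zero hf (mem_Icc_of_mem_window ht).1 (mem_Icc_of_mem_window ht).2
      (by omega)
  have hmean := ((((hasMean_sampleCrosscov hfLp hfLp h).const_mul As).mul_const Asᵀ).add
    ((hasMean_sampleCrosscov hfLp hN.memLp h).const_mul As)).add
    ((hasMean_sampleCrosscov hN.memLp hfLp h).mul_const Asᵀ) |>.add
    (hasMean_sampleCrosscov hN.memLp hN.memLp h)
  simp only [hfε, hεf, hεε, Matrix.mul_zero, Matrix.zero_mul, add_zero] at hmean
  refine (hasMean_sampleCrosscov hxLp hxLp h).unique ?_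
  exact (funext (sampleAutocov_eq_add hx n h) : sampleCrosscov x x n h = _) ▸ hmean

theorem covM_eq_sum_mul_mul_transpose [IsProbabilityMeasure P] (hγ : 1 ≤ γ) (hσf : 0 ≤ σf)
    (hf : ∀ t, Measurable (f t)) (hmom : CondMoment P f n γ σf) (hN : CondNoise P f ε n σε)
    (hx : ∀ t ω, x t ω = As *ᵥ f t ω + ε t ω) (h₀ : ℕ) :
    covM P x n h₀ = ∑ h ∈ Finset.Icc 1 h₀,
      (As * autocov P f n h * Asᵀ) * (As * autocov P f n h * Asᵀ)ᵀ :=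
  Finset.sum_congr rfl fun h hh => by
    rw [autocov_eq_mul_mul_transpose hγ hσf hf hmom hN hx (Finset.mem_Icc.1 hh).1]

theorem linearIndependent_col_of_condEigen_covM [IsProbabilityMeasure P] (hγ : 1 ≤ γ) (hσf : 0 ≤ σf)
    (hf : ∀ t, Measurable (f t)) (hmom : CondMoment P f n γ σf) (hN : CondNoise P f ε n σε)
    (hx : ∀ t ω, x t ω = As *ᵥ f t ω + ε t ω) {h₀ : ℕ} (hM : CondEigen r (covM P x n h₀)) :
    LinearIndependent ℝ (col As) := by
  rw [covM_eq_sum_mul_mul_transpose hγ hσf hf hmom hN hx] at hM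
  simp only [Matrix.mul_assoc As, ← Matrix.mul_sum] at hM
  exact linearIndependent_col_of_condEigen hM

end Decomposition

/-! ### Deviation of the sample autocovariances -/

section Deviation

open Matrix
open scoped Matrix.Norms.Frobenius

section Norm

variable {m n : Type*} [Fintype m] [Fintype n]

theorem frobenius_norm_sq_le_of_abs_le {A : Matrix m n ℝ} {C : ℝ} (hA : ∀ i j, |A i j| ≤ C) :
    ‖A‖ ^ 2 ≤ Fintype.card m * Fintype.card n * C ^ 2 := calc
  ‖A‖ ^ 2 = ∑ i, ∑ j, A i j ^ 2 := frobenius_norm_sq A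
  _ ≤ ∑ _i : m, ∑ _j : n, C ^ 2 :=
    Finset.sum_le_sum fun i _ => Finset.sum_le_sum fun j _ => sq_le_sq' (abs_le.1 (hA i j)).1
      (abs_le.1 (hA i j)).2
  _ = Fintype.card m * Fintype.card n * C ^ 2 := by
    simp only [Finset.sum_const, Finset.card_univ, nsmul_eq_mul, mul_assoc]

theorem frobenius_norm_mul_mul_transpose_le (A : Matrix m n ℝ) (B : Matrix n n ℝ) :
    ‖A * B * Aᵀ‖ ≤ ‖A‖ ^ 2 * ‖B‖ := calc
  ‖A * B * Aᵀ‖ ≤ ‖A * B‖ * ‖Aᵀ‖ := frobenius_norm_mul _ _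
  _ ≤ ‖A‖ * ‖B‖ * ‖A‖ := by
    rw [frobenius_norm_transpose]
    exact mul_le_mul_of_nonneg_right (frobenius_norm_mul _ _) (norm_nonneg _)
  _ = ‖A‖ ^ 2 * ‖B‖ := by ring

variable {Ω : Type*} [MeasurableSpace Ω] {P : Measure Ω} {Z : Ω → Matrix m n ℝ} {B : ℝ}

theorem aestronglyMeasurable_frobenius_norm
    (hZ : ∀ i j, AEStronglyMeasurable (fun ω => Z ω i j) P) :
    AEStronglyMeasurable (fun ω => ‖Z ω‖) P := by
  have hnorm : (fun ω => ‖Z ω‖) = fun ω => √(∑ i, ∑ j, Z ω i j ^ 2) := funext fun ω => by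
    rw [← frobenius_norm_sq, Real.sqrt_sq (norm_nonneg _)]
  have hmeas : ∀ i j, AEMeasurable (fun ω => Z ω i j) P := fun i j => (hZ i j).aemeasurable
  rw [hnorm]
  exact AEMeasurable.aestronglyMeasurable (by fun_prop)

theorem hasSecondMomentLE_frobenius_norm
    (hZ : ∀ i j, HasSecondMomentLE P (fun ω => Z ω i j) B) :
    HasSecondMomentLE P (fun ω => ‖Z ω‖) (Fintype.card m * Fintype.card n * B) := by
  have hint : ∀ i j, Integrable (fun ω => Z ω i j ^ 2) P := fun i j => (hZ i j).memLp.integrable_sq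
  have hint' : ∀ i, Integrable (fun ω => ∑ j, Z ω i j ^ 2) P := fun i =>
    integrable_finsetSum _ fun j _ => hint i j
  refine ⟨(memLp_two_iff_integrable_sq
    (aestronglyMeasurable_frobenius_norm fun i j => (hZ i j).memLp.1)).2 ?_, ?_⟩
  · simpa only [frobenius_norm_sq] using integrable_finsetSum _ fun i _ => hint' i
  calc ∫ ω, ‖Z ω‖ ^ 2 ∂P = ∑ i, ∑ j, ∫ ω, Z ω i j ^ 2 ∂P := by
        simp only [frobenius_norm_sq, integral_finsetSum _ fun i _ => hint' i,
          integral_finsetSum _ fun j _ => hint _ j]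
    _ ≤ ∑ _i : m, ∑ _j : n, B :=
        Finset.sum_le_sum fun i _ => Finset.sum_le_sum fun j _ => (hZ i j).integral_sq_le
    _ = Fintype.card m * Fintype.card n * B := by
        simp only [Finset.sum_const, Finset.card_univ, nsmul_eq_mul, mul_assoc]

end Norm

theorem inv_sub_mul_sum_eq_inv_card_mul_sum (n h : ℕ) (u : ℕ → ℝ) :
    ((n : ℝ) - (h : ℝ))⁻¹ * ∑ t ∈ Finset.Icc 1 (n - h), u t =
      ((Finset.Icc 1 (n - h)).card : ℝ)⁻¹ * ∑ t ∈ Finset.Icc 1 (n - h), u t := by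
  rcases le_total h n with hhn | hnh
  · rw [Nat.card_Icc, Nat.add_sub_cancel, Nat.cast_sub hhn]
  · simp only [Nat.sub_eq_zero_of_le hnh, Finset.Icc_eq_empty_of_lt zero_lt_one,
      Finset.sum_empty, mul_zero]

theorem div_card_window_le {n h : ℕ} (hn : 2 * h ≤ n) {B : ℝ} (hB : 0 ≤ B) :
    B / (Finset.Icc 1 (n - h)).card ≤ 2 * B / n := by
  rcases n.eq_zero_or_pos with rfl | hpos
  · simp
  have hhalf : (n : ℝ) / 2 ≤ (n - h : ℕ) := by
    have : (n : ℝ) ≤ 2 * (n - h : ℕ) := by exact_mod_cast (by omega : n ≤ 2 * (n - h))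
    linarith
  rw [Nat.card_Icc, Nat.add_sub_cancel]
  calc B / (n - h : ℕ) ≤ B / (n / 2) := by gcongr
    _ = 2 * B / n := by ring

variable {Ω : Type*} [MeasurableSpace Ω] {P : Measure Ω} {p r n h h₀ : ℕ}

theorem hasSecondMomentLE_norm_of_window {Z : Ω → Matrix (Fin p) (Fin r) ℝ} {B : ℝ} (hB : 0 ≤ B)
    (hn : 2 * h ≤ n)
    (hZ : ∀ i j, HasSecondMomentLE P (fun ω => Z ω i j) (B / (Finset.Icc 1 (n - h)).card)) :
    HasSecondMomentLE P (fun ω => ‖Z ω‖) (p * r * (2 * B / n)) := by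
  simpa only [Fintype.card_fin] using hasSecondMomentLE_frobenius_norm fun i j =>
    (hZ i j).mono (div_card_window_le hn hB)

variable [IsProbabilityMeasure P]
  {As : Matrix (Fin p) (Fin r) ℝ} {f : ℤ → Ω → Fin r → ℝ} {x ε : ℤ → Ω → Fin p → ℝ}
  {γ K σf σε C₁ : ℝ}

theorem hasSecondMomentLE_norm_sampleAutocov_factor_sub (hγ : 2 < γ) (hσf : 0 < σf)
    (hf : ∀ t, Measurable (f t)) (hmix : CondMixing P f γ K) (hmom : CondMoment P f n γ σf)
    (hn : 2 * h ≤ n) :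
    HasSecondMomentLE P (fun ω => ‖sampleAutocov f n h ω - autocov P f n h‖)
      (r * r * (2 * (2 * ((h + 1 + 9 * K) * σf ^ 4)) / n)) := by
  have hK := hmix.nonneg
  refine hasSecondMomentLE_norm_of_window (by positivity) hn fun i j => ?_
  simpa only [sampleAutocov, autocov, Matrix.sub_apply, of_apply,
    inv_sub_mul_sum_eq_inv_card_mul_sum, ← mul_sub, ← Finset.sum_sub_distrib]
    using hasSecondMomentLE_factor_average hγ hσf hf hmix hmom i j h

theorem hasSecondMomentLE_norm_sampleCrosscov_factor_noise (hγ : 1 ≤ γ) (hσf : 0 ≤ σf)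
    (hf : ∀ t, Measurable (f t)) (hε : ∀ t, Measurable (ε t)) (hmom : CondMoment P f n γ σf)
    (hN : CondNoise P f ε n σε) (hn : 2 * h ≤ n) :
    HasSecondMomentLE P (fun ω => ‖sampleCrosscov f ε n h ω‖)
      (r * p * (2 * (2 * (σε ^ 2 * σf ^ 2)) / n)) := by
  refine hasSecondMomentLE_norm_of_window (by positivity) hn fun i j => ?_
  simp only [sampleCrosscov, of_apply, inv_sub_mul_sum_eq_inv_card_mul_sum]
  exact hasSecondMomentLE_factor_noise_average hN hf hε hγ hσf hmom
    (fun t ht => (mem_Icc_of_mem_window ht).1) (fun t ht => (mem_Icc_of_mem_window ht).2)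
    (fun s t hst => by simpa using hst) i j

theorem hasSecondMomentLE_norm_sampleCrosscov_noise_factor (hγ : 1 ≤ γ) (hσf : 0 ≤ σf)
    (hf : ∀ t, Measurable (f t)) (hε : ∀ t, Measurable (ε t)) (hmom : CondMoment P f n γ σf)
    (hN : CondNoise P f ε n σε) (hn : 2 * h ≤ n) :
    HasSecondMomentLE P (fun ω => ‖sampleCrosscov ε f n h ω‖)
      (p * r * (2 * (2 * (σε ^ 2 * σf ^ 2)) / n)) := by
  refine hasSecondMomentLE_norm_of_window (by positivity) hn fun i j => ?_
  simp only [sampleCrosscov, of_apply, inv_sub_mul_sum_eq_inv_card_mul_sum, mul_comm (ε _ _ _)]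
  exact hasSecondMomentLE_factor_noise_average hN hf hε hγ hσf hmom
    (fun t ht => (mem_Icc_of_mem_window ht).2) (fun t ht => (mem_Icc_of_mem_window ht).1)
    Nat.cast_injective j i

theorem hasSecondMomentLE_norm_sampleCrosscov_noise (hf : ∀ t, Measurable (f t))
    (hε : ∀ t, Measurable (ε t)) (hN : CondNoise P f ε n σε) (hh : 1 ≤ h) (hn : 2 * h ≤ n) :
    HasSecondMomentLE P (fun ω => ‖sampleCrosscov ε ε n h ω‖)
      (p * p * (2 * (2 * (σε ^ 2 * σε ^ 2)) / n)) := by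
  refine hasSecondMomentLE_norm_of_window (by positivity) hn fun i j => ?_
  simpa only [sampleCrosscov, of_apply, inv_sub_mul_sum_eq_inv_card_mul_sum]
    using hasSecondMomentLE_noise_average hN hf hε hh i j

theorem norm_sampleAutocov_sub_autocov_le (hγ : 1 ≤ γ) (hσf : 0 ≤ σf)
    (hf : ∀ t, Measurable (f t)) (hmom : CondMoment P f n γ σf) (hN : CondNoise P f ε n σε)
    (hx : ∀ t ω, x t ω = As *ᵥ f t ω + ε t ω) (hh : 1 ≤ h) (ω : Ω) :
    ‖sampleAutocov x n h ω - autocov P x n h‖ ≤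
      ‖As‖ ^ 2 * ‖sampleAutocov f n h ω - autocov P f n h‖ + ‖As‖ * ‖sampleCrosscov f ε n h ω‖
        + (‖As‖ * ‖sampleCrosscov ε f n h ω‖ + ‖sampleCrosscov ε ε n h ω‖) := by
  have hdecomp : sampleAutocov x n h ω - autocov P x n h =
      As * (sampleAutocov f n h ω - autocov P f n h) * Asᵀ + As * sampleCrosscov f ε n h ω
        + (sampleCrosscov ε f n h ω * Asᵀ + sampleCrosscov ε ε n h ω) := by
    rw [sampleAutocov_eq_add hx, autocov_eq_mul_mul_transpose hγ hσf hf hmom hN hx hh,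
      Matrix.mul_sub, Matrix.sub_mul]
    abel
  have hεf : ‖sampleCrosscov ε f n h ω * Asᵀ‖ ≤ ‖As‖ * ‖sampleCrosscov ε f n h ω‖ := by
    simpa only [frobenius_norm_transpose, mul_comm] using
      frobenius_norm_mul (sampleCrosscov ε f n h ω) Asᵀ
  rw [hdecomp]
  exact (norm_add_le _ _).trans (add_le_add
    ((norm_add_le _ _).trans
      (add_le_add (frobenius_norm_mul_mul_transpose_le _ _) (frobenius_norm_mul _ _)))
    ((norm_add_le _ _).trans (add_le_add_left hεf _)))

/-- The constant `L` in the bound `L p² / n` for the second moment of the deviation of one sample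
autocovariance. Its three summands come from the factors, from the two mixed products, and from the
noise; `r ^ 2 * C₁ ^ 2` and its square account for the loadings. -/
noncomputable def deviationConst (r h₀ : ℕ) (K σf σε C₁ : ℝ) : ℝ :=
  16 * ((r ^ 2 * C₁ ^ 2) ^ 2 * ((h₀ + 1 + 9 * K) * σf ^ 4)
    + 2 * (r ^ 2 * C₁ ^ 2) * (σε ^ 2 * σf ^ 2) + σε ^ 2 * σε ^ 2)

theorem hasSecondMomentLE_deviation (hγ : 2 < γ) (hσf : 0 < σf) (hf : ∀ t, Measurable (f t))
    (hε : ∀ t, Measurable (ε t)) (hmix : CondMixing P f γ K) (hmom : CondMoment P f n γ σf)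
    (hN : CondNoise P f ε n σε) (hx : ∀ t ω, x t ω = As *ᵥ f t ω + ε t ω)
    (hAs : ∀ i j, |As i j| ≤ C₁) (hh : 1 ≤ h) (hh₀ : h ≤ h₀) (hn : 2 * h ≤ n) :
    HasSecondMomentLE P (fun ω => ‖sampleAutocov x n h ω - autocov P x n h‖)
      (deviationConst r h₀ K σf σε C₁ * p ^ 2 / n) := by
  have hK := hmix.nonneg
  have hγ1 : 1 ≤ γ := by linarith
  have hAs2 : ‖As‖ ^ 2 ≤ p * r * C₁ ^ 2 := by
    simpa only [Fintype.card_fin] using frobenius_norm_sq_le_of_abs_le hAs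
  have hx_meas : ∀ t, Measurable (x t) := fun t => by
    rw [show x t = fun ω => As *ᵥ f t ω + ε t ω from funext (hx t)]
    unfold Matrix.mulVec dotProduct
    fun_prop
  have hmeas : AEStronglyMeasurable (fun ω => ‖sampleAutocov x n h ω - autocov P x n h‖) P := by
    refine aestronglyMeasurable_frobenius_norm fun i j => ?_
    simp only [sampleAutocov, Matrix.sub_apply, of_apply]
    exact Measurable.aestronglyMeasurable (by fun_prop)
  have hff := hasSecondMomentLE_norm_sampleAutocov_factor_sub hγ hσf hf hmix hmom hn
  have hfε := hasSecondMomentLE_norm_sampleCrosscov_factor_noise hγ1 hσf.le hf hε hmom hN hn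
  have hεf := hasSecondMomentLE_norm_sampleCrosscov_noise_factor hγ1 hσf.le hf hε hmom hN hn
  have hεε := hasSecondMomentLE_norm_sampleCrosscov_noise hf hε hN hh hn
  have hdom := ((hff.const_mul (‖As‖ ^ 2)).add (hfε.const_mul ‖As‖)).add
    ((hεf.const_mul ‖As‖).add hεε)
  refine (hdom.of_abs_le hmeas fun ω => ?_).mono ?_
  · rw [abs_norm]
    exact norm_sampleAutocov_sub_autocov_le hγ1 hσf.le hf hmom hN hx hh ω
  · calc _ ≤ 2 * (2 * ((p * r * C₁ ^ 2) ^ 2 * (r * r * (2 * (2 * ((h₀ + 1 + 9 * K) * σf ^ 4)) / n))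
          + p * r * C₁ ^ 2 * (r * p * (2 * (2 * (σε ^ 2 * σf ^ 2)) / n)))
          + 2 * (p * r * C₁ ^ 2 * (p * r * (2 * (2 * (σε ^ 2 * σf ^ 2)) / n))
          + p * p * (2 * (2 * (σε ^ 2 * σε ^ 2)) / n))) := by gcongr
      _ = deviationConst r h₀ K σf σε C₁ * p ^ 2 / n := by unfold deviationConst; ring

end Deviation

/-! ### From autocovariances to loading spaces -/

section Subspace

open Matrix

section SpecNorm

open scoped Matrix.Norms.L2Operator in
theorem sum_sq_col_le_specNorm_sq {p r : ℕ} (Z : Matrix (Fin p) (Fin r) ℝ) (j : Fin r) :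
    ∑ i, Z i j ^ 2 ≤ specNorm Z ^ 2 := by
  have h := pow_le_pow_left₀ (norm_nonneg _)
    (Matrix.l2_opNorm_mulVec Z (EuclideanSpace.single j 1)) 2
  simpa [EuclideanSpace.norm_sq_eq, specNorm] using h

end SpecNorm

open scoped Matrix.Norms.Frobenius

theorem frobenius_norm_sq_le_specNorm_sq {p r : ℕ} (Z : Matrix (Fin p) (Fin r) ℝ) :
    ‖Z‖ ^ 2 ≤ r * specNorm Z ^ 2 := calc
  ‖Z‖ ^ 2 = ∑ j, ∑ i, Z i j ^ 2 := by rw [frobenius_norm_sq, Finset.sum_comm]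
  _ ≤ ∑ _j : Fin r, specNorm Z ^ 2 := Finset.sum_le_sum fun j _ => sum_sq_col_le_specNorm_sq Z j
  _ = r * specNorm Z ^ 2 := by simp only [Finset.sum_const, Finset.card_fin, nsmul_eq_mul]

theorem norm_mul_transpose_sub_mul_transpose_le {m n : Type*} [Fintype m] [Fintype n]
    (A B : Matrix m n ℝ) : ‖A * Aᵀ - B * Bᵀ‖ ≤ 2 * ‖B‖ * ‖A - B‖ + ‖A - B‖ ^ 2 := by
  have hexpand : A * Aᵀ - B * Bᵀ =
      (A - B) * Bᵀ + B * (A - B)ᵀ + (A - B) * (A - B)ᵀ := by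
    simp only [transpose_sub, Matrix.mul_sub, Matrix.sub_mul]
    abel
  calc ‖A * Aᵀ - B * Bᵀ‖ ≤ ‖A - B‖ * ‖Bᵀ‖ + ‖B‖ * ‖(A - B)ᵀ‖ + ‖A - B‖ * ‖(A - B)ᵀ‖ := by
        rw [hexpand]
        exact norm_add₃_le.trans (add_le_add_three (frobenius_norm_mul _ _)
          (frobenius_norm_mul _ _) (frobenius_norm_mul _ _))
    _ = 2 * ‖B‖ * ‖A - B‖ + ‖A - B‖ ^ 2 := by
        rw [frobenius_norm_transpose, frobenius_norm_transpose]
        ring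

theorem norm_sum_mul_transpose_sub_le {m n ι : Type*} [Fintype m] [Fintype n] (I : Finset ι)
    (A B : ι → Matrix m n ℝ) {V : ℝ} (hB : ∀ h ∈ I, ‖B h‖ ≤ V) :
    ‖∑ h ∈ I, A h * (A h)ᵀ - ∑ h ∈ I, B h * (B h)ᵀ‖ ≤
      2 * V * (∑ h ∈ I, ‖A h - B h‖) + (∑ h ∈ I, ‖A h - B h‖) ^ 2 := by
  have hterm : ∀ h ∈ I, ‖A h * (A h)ᵀ - B h * (B h)ᵀ‖ ≤
      2 * V * ‖A h - B h‖ + ‖A h - B h‖ ^ 2 := fun h hh =>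
    (norm_mul_transpose_sub_mul_transpose_le _ _).trans (by gcongr; exact hB h hh)
  have hsq : ∑ h ∈ I, ‖A h - B h‖ ^ 2 ≤ (∑ h ∈ I, ‖A h - B h‖) ^ 2 :=
    Finset.sum_sq_le_sq_sum_of_nonneg fun h _ => norm_nonneg (A h - B h)
  calc _ = ‖∑ h ∈ I, (A h * (A h)ᵀ - B h * (B h)ᵀ)‖ := by rw [Finset.sum_sub_distrib]
    _ ≤ ∑ h ∈ I, (2 * V * ‖A h - B h‖ + ‖A h - B h‖ ^ 2) := norm_sum_le_of_le I hterm
    _ ≤ _ := by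
      rw [Finset.sum_add_distrib, ← Finset.mul_sum]
      gcongr

variable {Ω : Type*} [MeasurableSpace Ω] {P : Measure Ω}
  {p r n h h₀ : ℕ} {As T : Matrix (Fin p) (Fin r) ℝ} {f : ℤ → Ω → Fin r → ℝ}
  {x ε : ℤ → Ω → Fin p → ℝ} {γ K σf σε C₁ c : ℝ}

/-- The total Frobenius deviation of the sample autocovariances of `y` at the lags `1, …, h₀`. -/
noncomputable def autocovDeviation (P : Measure Ω) {d : ℕ} (y : ℤ → Ω → Fin d → ℝ) (n h₀ : ℕ)
    (ω : Ω) : ℝ :=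
  ∑ h ∈ Finset.Icc 1 h₀, ‖sampleAutocov y n h ω - autocov P y n h‖

theorem autocovDeviation_nonneg {d : ℕ} (y : ℤ → Ω → Fin d → ℝ) (n h₀ : ℕ) (ω : Ω) :
    0 ≤ autocovDeviation P y n h₀ ω :=
  Finset.sum_nonneg fun _ _ => norm_nonneg _

variable [IsProbabilityMeasure P]

theorem abs_autocov_apply_le (hγ : 1 ≤ γ) (hσf : 0 ≤ σf) (hf : ∀ t, Measurable (f t))
    (hmom : CondMoment P f n γ σf) (i j : Fin r) : |autocov P f n h i j| ≤ σf ^ 2 := by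
  have hterm : ∀ t ∈ Finset.Icc 1 (n - h),
      |∫ ω, f (t : ℤ) ω i * f ((t : ℤ) + h) ω j ∂P| ≤ σf ^ 2 := fun t ht => by
    have hmem := mem_Icc_of_mem_window ht
    simpa only [Real.mul_self_sqrt (sq_nonneg σf)] using
      (hmom.hasSecondMomentLE hγ hσf hf hmem.1 i).abs_integral_mul_le
        (hmom.hasSecondMomentLE hγ hσf hf hmem.2 j)
  simp only [autocov, of_apply, inv_sub_mul_sum_eq_inv_card_mul_sum, abs_mul, abs_inv, Nat.abs_cast]
  calc _ ≤ ((Finset.Icc 1 (n - h)).card : ℝ)⁻¹ * ((Finset.Icc 1 (n - h)).card * σf ^ 2) := by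
        gcongr
        rw [← nsmul_eq_mul]
        exact (Finset.abs_sum_le_sum_abs _ _).trans (Finset.sum_le_card_nsmul _ _ _ hterm)
    _ ≤ σf ^ 2 := by
        rw [← mul_assoc]
        exact mul_le_of_le_one_left (sq_nonneg σf) inv_mul_le_one

theorem norm_autocov_factor_le (hγ : 1 ≤ γ) (hσf : 0 ≤ σf) (hf : ∀ t, Measurable (f t))
    (hmom : CondMoment P f n γ σf) : ‖autocov P f n h‖ ≤ r * σf ^ 2 := by
  refine le_of_sq_le_sq ?_ (by positivity)
  refine (frobenius_norm_sq_le_of_abs_le (abs_autocov_apply_le hγ hσf hf hmom)).trans_eq ?_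
  rw [Fintype.card_fin]
  ring

theorem norm_autocov_le (hγ : 1 ≤ γ) (hσf : 0 ≤ σf) (hf : ∀ t, Measurable (f t))
    (hmom : CondMoment P f n γ σf) (hN : CondNoise P f ε n σε)
    (hx : ∀ t ω, x t ω = As *ᵥ f t ω + ε t ω) (hh : 1 ≤ h) :
    ‖autocov P x n h‖ ≤ r ^ 2 * σf ^ 2 * specNorm As ^ 2 := calc
  ‖autocov P x n h‖ ≤ ‖As‖ ^ 2 * ‖autocov P f n h‖ := by
    rw [autocov_eq_mul_mul_transpose hγ hσf hf hmom hN hx hh]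
    exact frobenius_norm_mul_mul_transpose_le _ _
  _ ≤ r * specNorm As ^ 2 * (r * σf ^ 2) := mul_le_mul (frobenius_norm_sq_le_specNorm_sq As)
    (norm_autocov_factor_le hγ hσf hf hmom) (norm_nonneg _) (by positivity)
  _ = r ^ 2 * σf ^ 2 * specNorm As ^ 2 := by ring

theorem hasSecondMomentLE_autocovDeviation (hγ : 2 < γ) (hσf : 0 < σf)
    (hf : ∀ t, Measurable (f t)) (hε : ∀ t, Measurable (ε t)) (hmix : CondMixing P f γ K)
    (hmom : CondMoment P f n γ σf) (hN : CondNoise P f ε n σε)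
    (hx : ∀ t ω, x t ω = As *ᵥ f t ω + ε t ω) (hAs : ∀ i j, |As i j| ≤ C₁) (hn : 2 * h₀ ≤ n) :
    HasSecondMomentLE P (autocovDeviation P x n h₀)
      (h₀ ^ 2 * deviationConst r h₀ K σf σε C₁ * (p ^ 2 / n)) := by
  have hsum := HasSecondMomentLE.sum fun h (hh : h ∈ Finset.Icc 1 h₀) =>
    hasSecondMomentLE_deviation hγ hσf hf hε hmix hmom hN hx hAs (Finset.mem_Icc.1 hh).1
      (Finset.mem_Icc.1 hh).2 (by have := (Finset.mem_Icc.1 hh).2; omega)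
  refine hsum.mono (le_of_eq ?_)
  rw [Finset.sum_const, Nat.card_Icc, Nat.add_sub_cancel, nsmul_eq_mul]
  ring

theorem norm_mul_transpose_sub_le_of_isEigenEstimator (hγ : 1 ≤ γ) (hσf : 0 ≤ σf) (hc : 0 < c)
    (hf : ∀ t, Measurable (f t)) (hmom : CondMoment P f n γ σf) (hN : CondNoise P f ε n σε)
    (hx : ∀ t ω, x t ω = As *ᵥ f t ω + ε t ω) (hli : LinearIndependent ℝ (col As))
    (hcov : (covM P f n h₀ - c • (1 : Matrix (Fin r) (Fin r) ℝ)).PosSemidef)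
    (hmin : 0 < minSing As ^ 2) {S : Matrix (Fin p) (Fin r) ℝ} {R : Matrix (Fin r) (Fin r) ℝ}
    (hS : Sᵀ * S = 1) (hSR : S * R = As) {ω : Ω}
    (hT : IsEigenEstimator (sampleM x n h₀ ω) T) :
    ‖T * Tᵀ - S * Sᵀ‖ ≤ 2 * (2 * (r ^ 2 * σf ^ 2 * specNorm As ^ 2) * autocovDeviation P x n h₀ ω
      + autocovDeviation P x n h₀ ω ^ 2) / (c * (minSing As ^ 2) ^ 2) := by
  have hR : (Rᵀ * R - minSing As ^ 2 • (1 : Matrix (Fin r) (Fin r) ℝ)).PosSemidef := by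
    have hRR : Rᵀ * R = Asᵀ * As := by
      rw [← hSR, transpose_mul, Matrix.mul_assoc, ← Matrix.mul_assoc Sᵀ, hS, Matrix.one_mul]
    rw [hRR]
    exact posSemidef_transpose_mul_sub_minSing hli
  have hcovM : covM P x n h₀ = S * (R * (∑ h ∈ Finset.Icc 1 h₀,
      autocov P f n h * (Asᵀ * As) * (autocov P f n h)ᵀ) * Rᵀ) * Sᵀ := by
    rw [covM_eq_sum_mul_mul_transpose hγ hσf hf hmom hN hx]
    simp only [← hSR, transpose_mul, transpose_transpose, Matrix.mul_assoc, Matrix.mul_sum,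
      Matrix.sum_mul]
  have hdk := norm_mul_transpose_sub_le_of_trace_le (by positivity) hS hT.1
    (posSemidef_sum_mul_mul_transpose_sub (Finset.Icc 1 h₀) (autocov P f n) hc.le hmin.le hcov
      (posSemidef_transpose_mul_sub_minSing hli) (posSemidef_mul_transpose_sub_smul_one hR))
    (hT.2 S hS)
  rw [← hcovM] at hdk
  refine hdk.trans ?_
  gcongr
  exact norm_sum_mul_transpose_sub_le _ _ _ fun h hh =>
    norm_autocov_le hγ hσf hf hmom hN hx (Finset.mem_Icc.1 hh).1

end Subspace

section Distance

open Matrix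

/-- The constant `C` in the bound `C D / q` for the distance of the loading spaces, where `D` is the
total deviation of the sample autocovariances and `a q ≤ ‖Aˢ‖_min² ≤ ‖Aˢ‖₂² ≤ b q`. -/
noncomputable def distConst (r : ℕ) (σf c a b : ℝ) : ℝ :=
  2 * (2 * (r ^ 2 * σf ^ 2 * b) + 1) / (c * a ^ 2) + 2 * r

-- The a priori bound `b` takes over as soon as the perturbation `D` exceeds the scale `q`.
theorem le_div_mul_of_le_quadratic {X D V q l v κ b : ℝ} (hquad : X ≤ 2 * (2 * V * D + D ^ 2) / l)
    (hb : X ≤ b) (hV : V ≤ v * q) (hl : κ * q ^ 2 ≤ l) (hq : 0 < q) (hκ : 0 < κ) (hD : 0 ≤ D)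
    (hv : 0 ≤ v) (hb0 : 0 ≤ b) : X ≤ (2 * (2 * v + 1) / κ + b) / q * D := by
  have hsplit : (2 * (2 * v + 1) / κ + b) / q * D =
      2 * (2 * (v * q) * D + q * D) / (κ * q ^ 2) + b * (D / q) := by
    field_simp
  rw [hsplit]
  rcases le_total D q with hDq | hqD
  · calc X ≤ 2 * (2 * V * D + D ^ 2) / l := hquad
      _ ≤ 2 * (2 * (v * q) * D + q * D) / (κ * q ^ 2) := by
        rw [sq D]
        gcongr
      _ ≤ _ := le_add_of_nonneg_right (by positivity)
  · calc X ≤ b * 1 := by rwa [mul_one]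
      _ ≤ b * (D / q) := by
        gcongr
        exact (one_le_div hq).2 hqD
      _ ≤ _ := le_add_of_nonneg_left (by positivity)

variable {Ω : Type*} [MeasurableSpace Ω] {P : Measure Ω} [IsProbabilityMeasure P]
  {p r n h₀ : ℕ} {As T : Matrix (Fin p) (Fin r) ℝ} {f : ℤ → Ω → Fin r → ℝ}
  {x ε : ℤ → Ω → Fin p → ℝ} {γ K σf σε C₁ c a b q : ℝ}

theorem projDist_traceDist_le_autocovDeviation (hr : 1 ≤ r) (hγ : 1 ≤ γ) (hσf : 0 ≤ σf)
    (hc : 0 < c) (hf : ∀ t, Measurable (f t)) (hmom : CondMoment P f n γ σf)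
    (hN : CondNoise P f ε n σε) (hx : ∀ t ω, x t ω = As *ᵥ f t ω + ε t ω)
    (hli : LinearIndependent ℝ (col As))
    (hcov : (covM P f n h₀ - c • (1 : Matrix (Fin r) (Fin r) ℝ)).PosSemidef)
    (hq : 0 < q) (ha : 0 < a) (hb : 0 ≤ b) (hmin : a * q ≤ minSing As ^ 2)
    (hspec : specNorm As ^ 2 ≤ b * q) {ω : Ω} (hT : IsEigenEstimator (sampleM x n h₀ ω) T) :
    projDist (colSpace T) (colSpace (orthLoading As)) ≤
        distConst r σf c a b / q * autocovDeviation P x n h₀ ω ∧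
      traceDist r (colSpace T) (colSpace (orthLoading As)) ≤
        distConst r σf c a b / q * autocovDeviation P x n h₀ ω := by
  obtain ⟨S, R, hS, hSAs, hSR⟩ := exists_orthonormal_factor hli
  have hmin0 : 0 < minSing As ^ 2 := (mul_pos ha hq).trans_le hmin
  have hV : r ^ 2 * σf ^ 2 * specNorm As ^ 2 ≤ r ^ 2 * σf ^ 2 * b * q := by
    rw [mul_assoc _ b]
    gcongr
  have hl : c * a ^ 2 * q ^ 2 ≤ c * (minSing As ^ 2) ^ 2 := by
    rw [mul_assoc, ← mul_pow]
    gcongr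
  have hnorm := le_div_mul_of_le_quadratic
    (norm_mul_transpose_sub_le_of_isEigenEstimator hγ hσf hc hf hmom hN hx hli hcov hmin0 hS hSR hT)
    (norm_mul_transpose_sub_le hS hT.1) hV hl hq (by positivity)
    (autocovDeviation_nonneg x n h₀ ω) (by positivity) (by positivity)
  rw [Fintype.card_fin] at hnorm
  rw [colSpace_orthLoading hli, ← hSAs]
  exact ⟨(projDist_colSpace_le hS hT.1).trans hnorm, (traceDist_colSpace_le hr hS hT.1).trans hnorm⟩

end Distance

/-! ### The rate -/

theorem rate_eq_div (m p n : ℕ) (δ : ℝ) : rate m p n δ = p / √n / (m : ℝ) ^ (1 - δ) := by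
  rw [rate, ← neg_sub 1 δ, Real.rpow_neg (Nat.cast_nonneg _), Real.rpow_neg (Nat.cast_nonneg _),
    ← Real.sqrt_eq_rpow]
  ring

theorem rate_sq (m p n : ℕ) (δ : ℝ) :
    rate m p n δ ^ 2 = p ^ 2 / n / ((m : ℝ) ^ (1 - δ)) ^ 2 := by
  rw [rate_eq_div, div_pow, div_pow, Real.sq_sqrt (Nat.cast_nonneg _)]

theorem rate_pos {m p n : ℕ} {δ : ℝ} (hm : 0 < (m : ℝ) ^ (1 - δ)) (hp : 0 < p) (hn : 0 < n) :
    0 < rate m p n δ := by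
  rw [rate_eq_div]
  positivity

theorem AsympEq.exists_eventually_bounds {a b : ℕ → ℝ} (h : AsympEq a b) (hb : ∀ k, 0 ≤ b k) :
    ∃ c C, 0 < c ∧ 0 < C ∧ ∀ᶠ k in atTop, 0 < b k ∧ c * b k ≤ a k ∧ a k ≤ C * b k := by
  obtain ⟨c, hc, hlim⟩ := h
  refine ⟨c / 2, 2 * c, by positivity, by positivity, ?_⟩
  filter_upwards [hlim.eventually (Ioo_mem_nhds (half_lt_self hc) (lt_two_mul_self hc))]
    with k ⟨hlow, hup⟩
  have hbk : 0 < b k := (hb k).lt_of_ne' fun h0 => by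
    rw [h0, div_zero] at hlow
    linarith
  exact ⟨hbk, ((lt_div_iff₀ hbk).1 hlow).le, ((div_lt_iff₀ hbk).1 hup).le⟩

theorem HasSecondMomentLE.div_mul_rate {Ω : Type*} [MeasurableSpace Ω] {P : Measure Ω} {D : Ω → ℝ}
    {L : ℝ} {m p n : ℕ} (hD : HasSecondMomentLE P D (L * (p ^ 2 / n))) (C δ : ℝ) :
    HasSecondMomentLE P (fun ω => C / (m : ℝ) ^ (1 - δ) * D ω)
      (C ^ 2 * L * rate m p n δ ^ 2) := by
  refine (hD.const_mul _).mono (le_of_eq ?_)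
  rw [rate_sq]
  ring

end FactorModel

open FactorModel in
theorem theorem1_general (r h₀ : ℕ) (hr : 1 ≤ r)
    (γ K σf σε δ C₁ c : ℝ) (hγ : 2 < γ) (hσf : 0 < σf) (hc : 0 < c)
    (p n : ℕ → ℕ) (hn : Tendsto n atTop atTop)
    {Ω : ℕ → Type*} [∀ k, MeasurableSpace (Ω k)] (P : ∀ k, Measure (Ω k))
    [∀ k, IsProbabilityMeasure (P k)] (As : ∀ k, Matrix (Fin (p k)) (Fin r) ℝ)
    (fs : ∀ k, ℤ → Ω k → Fin r → ℝ) (x ε : ∀ k, ℤ → Ω k → Fin (p k) → ℝ)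
    (hfs_meas : ∀ k t, Measurable (fs k t)) (hε_meas : ∀ k t, Measurable (ε k t))
    (hxs : ∀ k t ω, x k t ω = Matrix.mulVec (As k) (fs k t ω) + ε k t ω)
    (hmix : ∀ k, CondMixing (P k) (fs k) γ K)
    (hmom : ∀ k, CondMoment (P k) (fs k) (n k) γ σf)
    (hN : ∀ k, CondNoise (P k) (fs k) (ε k) (n k) σε)
    (hstrength : CondStrength p As δ C₁)
    (hli : ∀ᶠ k in atTop, LinearIndependent ℝ (col (As k)))
    (hcov : ∀ᶠ k in atTop,
      (covM (P k) (fs k) (n k) h₀ - c • (1 : Matrix (Fin r) (Fin r) ℝ)).PosSemidef)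
    (Shat : ∀ k, Ω k → Matrix (Fin (p k)) (Fin r) ℝ)
    (hShat : ∀ᶠ k in atTop, ∀ ω, IsEigenEstimator (sampleM (x k) (n k) h₀ ω) (Shat k ω)) :
    IsBigOp P (fun k ω => projDist (colSpace (Shat k ω)) (colSpace (orthLoading (As k))))
        (fun k => rate (nnz (As k)) (p k) (n k) δ) ∧
      IsBigOp P (fun k ω => traceDist r (colSpace (Shat k ω)) (colSpace (orthLoading (As k))))
        (fun k => rate (nnz (As k)) (p k) (n k) δ) := by
  have hscale : ∀ k, 0 ≤ (nnz (As k) : ℝ) ^ (1 - δ) := fun k => by positivity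
  obtain ⟨_, b, -, hb, hspec⟩ := hstrength.specNorm_sq.exists_eventually_bounds hscale
  obtain ⟨a, _, ha, -, hmin⟩ := hstrength.minSing_sq.exists_eventually_bounds hscale
  set C := distConst r σf c a b
  let B := C ^ 2 * (h₀ ^ 2 * deviationConst r h₀ K σf σε C₁)
  let Y k (ω : Ω k) := C / (nnz (As k) : ℝ) ^ (1 - δ) * autocovDeviation (P k) (x k) (n k) h₀ ω
  have hdist : ∀ᶠ k in atTop, ∀ ω,
      projDist (colSpace (Shat k ω)) (colSpace (orthLoading (As k))) ≤ Y k ω ∧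
        traceDist r (colSpace (Shat k ω)) (colSpace (orthLoading (As k))) ≤ Y k ω := by
    filter_upwards [hspec, hmin, hli, hcov, hShat] with k hspec hmin hli hcov hShat ω using
      projDist_traceDist_le_autocovDeviation hr (by linarith) hσf.le hc (hfs_meas k) (hmom k) (hN k)
        (hxs k) hli hcov hmin.1 ha hb.le hmin.2.1 hspec.2.2 (hShat ω)
  have hdev : ∀ᶠ k in atTop, HasSecondMomentLE (P k) (Y k)
      (B * rate (nnz (As k)) (p k) (n k) δ ^ 2) := by
    filter_upwards [hn.eventually_ge_atTop (2 * h₀)] with k hnk using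
      (hasSecondMomentLE_autocovDeviation hγ hσf (hfs_meas k) (hε_meas k) (hmix k) (hmom k) (hN k)
        (hxs k) (hstrength.max_le k) hnk).div_mul_rate C δ
  have hrate : ∀ᶠ k in atTop, 0 < rate (nnz (As k)) (p k) (n k) δ := by
    filter_upwards [hmin, hli, hn.eventually_gt_atTop 0] with k hmin hli hnk
    refine rate_pos hmin.1 (hr.trans ?_) hnk
    simpa only [Fintype.card_fin, finrank_euclideanSpace_fin] using hli.fintype_card_le_finrank
  refine ⟨isBigOp_of_hasSecondMomentLE (B := B) hrate ?_,
    isBigOp_of_hasSecondMomentLE (B := B) hrate ?_⟩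
  · filter_upwards [hdist, hdev] with k hdist hdev using
      ⟨Y k, fun ω => (abs_of_nonneg (norm_nonneg _)).trans_le (hdist ω).1, hdev⟩
  · filter_upwards [hdist, hdev] with k hdist hdev using
      ⟨Y k, fun ω => (abs_of_nonneg (Real.sqrt_nonneg _)).trans_le (hdist ω).2, hdev⟩

theorem theorem1
    -- fixed constants
    (r h₀ : ℕ) (hr : 1 ≤ r) (hh₀ : 1 ≤ h₀)
    (γ K σf σε δ C₁ c : ℝ) (hγ : 2 < γ) (hσf : 0 < σf) (hσε : 0 < σε)
    (hδ : δ ∈ Set.Icc (0 : ℝ) 1) (hC₁ : 0 < C₁) (hc : 0 < c)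
    -- the asymptotic regime: dimension and sample size tend to infinity
    (p n : ℕ → ℕ) (hp : Filter.Tendsto p Filter.atTop Filter.atTop)
    (hn : Filter.Tendsto n Filter.atTop Filter.atTop)
    -- the model `x_t = A f_t + ε_t = Aˢ f_tˢ + ε_t`
    {Ω : ℕ → Type*} [∀ k, MeasurableSpace (Ω k)] (P : ∀ k, MeasureTheory.Measure (Ω k))
    [∀ k, MeasureTheory.IsProbabilityMeasure (P k)]
    (A As : ∀ k, Matrix (Fin (p k)) (Fin r) ℝ)
    (f fs : ∀ k, ℤ → Ω k → Fin r → ℝ) (x ε : ∀ k, ℤ → Ω k → Fin (p k) → ℝ)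
    (hfs_meas : ∀ k t, Measurable (fs k t)) (hε_meas : ∀ k t, Measurable (ε k t))
    (hx : ∀ k t ω, x k t ω = Matrix.mulVec (A k) (f k t ω) + ε k t ω)
    (hxs : ∀ k t ω, x k t ω = Matrix.mulVec (As k) (fs k t ω) + ε k t ω)
    (hAs : ∀ k, FactorModel.IsSparseLoading (A k) (As k))
    -- mixing, moments, noise, factor strength, eigenvalues
    (hC1 : ∀ k, FactorModel.CondMixing (P k) (fs k) γ K)
    (hC2 : ∀ k, FactorModel.CondMoment (P k) (fs k) (n k) γ σf)
    (hC3 : ∀ k, FactorModel.CondNoise (P k) (fs k) (ε k) (n k) σε)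
    (hC4 : FactorModel.CondStrength p As δ C₁)
    (hC5 : ∀ᶠ k in Filter.atTop,
      FactorModel.CondEigen r (FactorModel.covM (P k) (x k) (n k) h₀))
    -- the lagged factor autocovariances do not degenerate in the limit
    (hC5' : ∀ᶠ k in Filter.atTop,
      (FactorModel.covM (P k) (fs k) (n k) h₀ - c • (1 : Matrix (Fin r) (Fin r) ℝ)).PosSemidef)
    (hrate : Filter.Tendsto (fun k => FactorModel.rate (FactorModel.nnz (As k)) (p k) (n k) δ)
      Filter.atTop (nhds 0))
    -- the estimator
    (Shat : ∀ k, Ω k → Matrix (Fin (p k)) (Fin r) ℝ)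
    (hShat : ∀ᶠ k in Filter.atTop, ∀ ω,
      FactorModel.IsEigenEstimator (FactorModel.sampleM (x k) (n k) h₀ ω) (Shat k ω)) :
    FactorModel.IsBigOp P
        (fun k ω => FactorModel.projDist (FactorModel.colSpace (Shat k ω))
          (FactorModel.colSpace (FactorModel.orthLoading (As k))))
        (fun k => FactorModel.rate (FactorModel.nnz (As k)) (p k) (n k) δ) ∧
      FactorModel.IsBigOp P
        (fun k ω => FactorModel.traceDist r (FactorModel.colSpace (Shat k ω))
          (FactorModel.colSpace (FactorModel.orthLoading (As k))))
        (fun k => FactorModel.rate (FactorModel.nnz (As k)) (p k) (n k) δ) :=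
  theorem1_general r h₀ hr γ K σf σε δ C₁ c hγ hσf hc p n hn P As fs x ε hfs_meas hε_meas hxs
    hC1 hC2 hC3 hC4 (hC5.mono fun k => FactorModel.linearIndependent_col_of_condEigen_covM
      (by linarith) hσf.le (hfs_meas k) (hC2 k) (hC3 k) (hxs k)) hC5' Shat hShat
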